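/- Let $S=\mathbb{C}[X_1,\dots,X_n]$ with its standard grading, let $W$ be a finite group all of whose finite-dimensional complex representations are self-dual, and let $W$ act on $S$ by grading-preserving $\mathbb{C}$-algebra automorphisms. Put $R=S^W$ and assume that $S/(S\cdot R_{>0})$ is finite-dimensional. Let $A=S*W$ be the skew group algebra, graded by $A_i=S_i\otimes\mathbb{C}W$. For a graded $A$-module $M$ let $M\langle d\rangle$ be the shift $(M\langle d\rangle)_i=M_{i-d}$, and for graded modules write $\operatorname{Hom}_A(M,N)_d$ for the $A$-linear maps of degree $d$ and $\operatorname{Ext}^i_A(M,N)_d=\operatorname{Ext}^i_{A\text{-gmod}}(M,N\langle -d\rangle)$, where $A$-gmod is the category of finitely generated graded $A$-modules. Let $\operatorname{Irr}W$ be the set of isomorphism classes of irreducible complex representations of $W$. For $\lambda\in\operatorname{Irr}W$ let $P_\lambda=S\otimes_{\mathbb{C}}\lambda$, and for a graded module $M$ put $[M:L_\lambda]_q=\sum_{i}q^i[M_i:\lambda]$, where $[M_i:\lambda]$ is the multiplicity of $\lambda$ in the $W$-representation $M_i$. Let $\precsim$ be a preorder on $\operatorname{Irr}W$ and write $\lambda\prec\mu$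 if $\lambda\precsim\mu$ and not $\mu\precsim\lambda$. Define $$K_\lambda=P_\lambda\Big/\sum_{\mu\succsim\lambda,\ d>0,\ f\in\operatorname{Hom}_A(P_\mu,P_\lambda)_{d}}\operatorname{Im}f,\qquad \widetilde K_\lambda=P_\lambda\Big/\sum_{\mu\succ\lambda,\ d>0,\ f\in\operatorname{Hom}_A(P_\mu,P_\lambda)_{d}}\operatorname{Im}f .$$ The modules $K_\lambda$ are finite-dimensional; let $K_\lambda^*=\operatorname{Hom}_{\mathbb{C}}(K_\lambda,\mathbb{C})$, with $(K_\lambda^*)_i=\operatorname{Hom}_{\mathbb C}((K_\lambda)_{-i},\mathbb C)$ and the action $((s\otimes w)f)(m)=f((w^{-1}(s)\otimes w^{-1})m)$. For a family $F=\{F_\alpha\}$ of graded modules, an $F$-filtration of a graded module $M$ is a sequence $M=M^0\supseteq M^1\supseteq\cdots$ of graded submodules with $\bigcap_i M^i=0$ such that every factor $M^{i-1}/M^i$ is zero or isomorphic, as a graded module, to $F_\alpha\langle d\rangle$ for some $\alpha$ and some $d\in\mathbb{Z}$. Its multiplicity of $F_\alpha$ is the formal Laurent series $\sum_d m_d q^d$,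 where $m_d$ is the (finite) number of factors isomorphic to $F_\alpha\langle d\rangle$. Suppose that the following three conditions hold: (a) for all $\lambda,\mu\in\operatorname{Irr}W$, $\operatorname{Ext}^i_A(\widetilde K_\lambda,K_\mu^*)_d$ is $\mathbb{C}$ if $i=d=0$ and $\lambda=\mu$, and is $0$ otherwise; (b) every $P_\lambda$ has a $\{\widetilde K_\mu\}_\mu$-filtration; (c) every $\widetilde K_\lambda$ has a $\{K_\mu\}_\mu$-filtration. Then: (1) For all $\lambda,\mu\in\operatorname{Irr}W$, the multiplicity $(\widetilde K_\lambda:K_\mu)_q$ of $K_\mu$ is the same in every $K$-filtration of $\widetilde K_\lambda$, and the matrix $(\widetilde K:K)=((\widetilde K_\lambda:K_\mu)_q)_{\lambda,\mu}$ is symmetric. (2) Every $P_\lambda$ has a $K$-filtration, and in every $K$-filtration of $P_\lambda$ the multiplicity of $K_\mu$ is $(P_\lambda:K_\mu)_q=[\widetilde K_\mu:L_\lambda]_q$. That is, $(P:K)=[\widetilde K:L]^{\mathsf t}$; in particular $(P:K)$ does not depend on the chosen filtrations. -/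

import Mathlib

open scoped TensorProduct LaurentSeries

namespace SkewK

noncomputable section

/-! ### Decompositions of vector spaces indexed by the integers -/

section Decomp

variable {M : Type*} [AddCommGroup M] [Module ℂ M]

/-- Linear maps that act as the projections onto the pieces of a spanning family of subspaces show
that the family is a direct sum decomposition. -/
theorem isInternal_of_proj (D : ℤ → Submodule ℂ M) (π : ℤ → M →ₗ[ℂ] M)
    (h1 : ∀ i, ∀ m ∈ D i, π i m = m) (h2 : ∀ i j, i ≠ j → ∀ m ∈ D j, π i m = 0)
    (h3 : ⨆ i, D i = ⊤) : DirectSum.IsInternal D := by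
  refine DirectSum.isInternal_submodule_of_iSupIndep_of_iSup_eq_top ?_ h3
  rw [iSupIndep_def]
  intro i
  rw [Submodule.disjoint_def]
  intro x hx hx'
  have hle : (⨆ j, ⨆ (_ : j ≠ i), D j) ≤ LinearMap.ker (π i) := by
    refine iSup_le fun j => iSup_le fun hj => ?_
    intro m hm
    exact h2 i j (Ne.symm hj) m hm
  have := hle hx'
  rw [LinearMap.mem_ker, h1 i x hx] at this
  exact this

/-- The projection onto the piece `D i` of a direct sum decomposition `D`. -/
def internalProj {D : ℤ → Submodule ℂ M} (h : DirectSum.IsInternal D) (i : ℤ) : M →ₗ[ℂ] M :=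
  (D i).subtype ∘ₗ DirectSum.component ℂ ℤ (fun i => D i) i ∘ₗ
    (LinearEquiv.ofBijective (DirectSum.coeLinearMap D) h).symm.toLinearMap

variable {D : ℤ → Submodule ℂ M} (h : DirectSum.IsInternal D)

theorem internalProj_mem (i : ℤ) (x : M) : internalProj h i x ∈ D i := by
  simp [internalProj]

theorem internalProj_coe (i : ℤ) (y : DirectSum ℤ fun i => D i) :
    internalProj h i (DirectSum.coeLinearMap D y) = y i := by
  have : (LinearEquiv.ofBijective (DirectSum.coeLinearMap D) h).symm
      (DirectSum.coeLinearMap D y) = y :=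
    (LinearEquiv.ofBijective (DirectSum.coeLinearMap D) h).symm_apply_apply y
  simp only [internalProj, LinearMap.comp_apply, LinearEquiv.coe_coe, this]
  rfl

theorem internalProj_same (i : ℤ) (x : M) (hx : x ∈ D i) : internalProj h i x = x := by
  have := internalProj_coe h i (DirectSum.lof ℂ ℤ (fun i => D i) i ⟨x, hx⟩)
  rw [DirectSum.coeLinearMap_lof, DirectSum.lof_apply] at this
  exact this

theorem internalProj_ne (i j : ℤ) (hij : i ≠ j) (x : M) (hx : x ∈ D j) :
    internalProj h i x = 0 := by
  have := internalProj_coe h i (DirectSum.lof ℂ ℤ (fun i => D i) j ⟨x, hx⟩)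
  rw [DirectSum.coeLinearMap_lof] at this
  rw [this, DirectSum.lof_eq_of, DirectSum.of_eq_of_ne _ _ _ hij]
  rfl

theorem exists_sum_internalProj (x : M) : ∃ s : Finset ℤ, ∑ i ∈ s, internalProj h i x = x := by
  classical
  obtain ⟨y, rfl⟩ := h.2 x
  refine ⟨DFinsupp.support y, ?_⟩
  conv_rhs => rw [← DirectSum.sum_support_of y]
  rw [map_sum]
  refine Finset.sum_congr rfl fun i _ => ?_
  rw [DirectSum.coeAddMonoidHom_of]
  exact internalProj_coe h i y

end Decomp

/-! ### The polynomial ring with a group action and its skew group algebra -/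

/-- The polynomial ring `S = ℂ[X₁, …, Xₙ]`. -/
abbrev Poly (n : ℕ) : Type := MvPolynomial (Fin n) ℂ

/-- The homogeneous part `S_i`, for `i : ℤ`; every variable has degree `1`. -/
def polyGrade (n : ℕ) (i : ℤ) : Submodule ℂ (Poly n) :=
  MvPolynomial.weightedHomogeneousSubmodule ℂ (fun _ : Fin n => (1 : ℤ)) i

/-- The action of `W` on `S` preserves the grading of `S`. -/
class PreservesGrading (n : ℕ) (W : Type*) [Group W] [MulSemiringAction W (Poly n)] : Prop where
  smul_mem : ∀ (w : W) (i : ℤ) (p : Poly n), p ∈ polyGrade n i → w • p ∈ polyGrade n i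

/-- The skew group algebra `S * W`: the product of `s ⊗ w` and `s' ⊗ w'` is `s w(s') ⊗ w w'`. -/
def Skew (n : ℕ) (W : Type*) [Group W] [MulSemiringAction W (Poly n)] : Type _ :=
  SkewMonoidAlgebra (Poly n) W

instance (n : ℕ) (W : Type*) [Group W] [MulSemiringAction W (Poly n)] : Ring (Skew n W) :=
  inferInstanceAs (Ring (SkewMonoidAlgebra (Poly n) W))

instance (n : ℕ) (W : Type*) [Group W] [MulSemiringAction W (Poly n)] [SMulCommClass W ℂ (Poly n)] :
    Algebra ℂ (Skew n W) :=
  inferInstanceAs (Algebra ℂ (SkewMonoidAlgebra (Poly n) W))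

namespace Skew

section

variable {n : ℕ} {W : Type*} [Group W] [MulSemiringAction W (Poly n)]

/-- The element `s ⊗ w` of `S * W`. -/
def of (s : Poly n) (w : W) : Skew n W := SkewMonoidAlgebra.single w s

/-- The coefficient `s_w` of `∑ s_w ⊗ w`. -/
def coeff (a : Skew n W) (w : W) : Poly n := SkewMonoidAlgebra.coeff a w

theorem one_def : (1 : Skew n W) = of 1 1 := SkewMonoidAlgebra.one_def

theorem of_mul_of (s t : Poly n) (v w : W) :
    (of s v * of t w : Skew n W) = of (s * v • t) (v * w) :=
  SkewMonoidAlgebra.single_mul_single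

theorem of_zero (w : W) : (of 0 w : Skew n W) = 0 := SkewMonoidAlgebra.single_zero w

theorem of_add (s t : Poly n) (w : W) : (of (s + t) w : Skew n W) = of s w + of t w :=
  SkewMonoidAlgebra.single_add w s t

theorem smul_of [SMulCommClass W ℂ (Poly n)] (c : ℂ) (s : Poly n) (w : W) :
    (c • of s w : Skew n W) = of (c • s) w :=
  SkewMonoidAlgebra.smul_single c w s

theorem coeff_zero (w : W) : coeff (0 : Skew n W) w = 0 := by
  change (SkewMonoidAlgebra.coeff (0 : SkewMonoidAlgebra (Poly n) W)) w = 0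
  rw [SkewMonoidAlgebra.coeff_zero]; rfl

theorem coeff_add (a b : Skew n W) (w : W) : coeff (a + b) w = coeff a w + coeff b w :=
  DFunLike.congr_fun (SkewMonoidAlgebra.coeff_add a b) w

theorem coeff_smul [SMulCommClass W ℂ (Poly n)] (c : ℂ) (a : Skew n W) (w : W) :
    coeff (c • a) w = c • coeff a w :=
  DFunLike.congr_fun (SkewMonoidAlgebra.coeff_smul c a) w

theorem coeff_of_same (s : Poly n) (w : W) : coeff (of s w) w = s := by
  classical
  exact (SkewMonoidAlgebra.coeff_single_apply (a := w) (a' := w) (b := s)).trans (if_pos rfl)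

theorem coeff_of_ne (s : Poly n) {v w : W} (h : v ≠ w) : coeff (of s v) w = 0 := by
  classical
  exact (SkewMonoidAlgebra.coeff_single_apply (a := v) (a' := w) (b := s)).trans (if_neg h)

theorem exists_sum_of (a : Skew n W) : ∃ t : Finset W, a = ∑ w ∈ t, of (coeff a w) w :=
  ⟨SkewMonoidAlgebra.support a,
    ((SkewMonoidAlgebra.sum_def' a _).symm.trans (SkewMonoidAlgebra.sum_single a)).symm⟩

theorem induction {p : Skew n W → Prop} (zero : p 0) (of : ∀ s w, p (of s w))
    (add : ∀ a b, p a → p b → p (a + b)) (a : Skew n W) : p a :=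
  SkewMonoidAlgebra.induction_on (p := p) a zero (fun w s => of s w) (fun a b ha hb => add a b ha hb)

/-- A ring homomorphism out of `S * W` from compatible maps out of `S` and `W`. -/
def lift {R : Type*} [Semiring R] (f : Poly n →+* R) (g : W →* R)
    (h : ∀ (s : Poly n) (w : W), f (w • s) * g w = g w * f s) : Skew n W →+* R :=
  SkewMonoidAlgebra.liftNCRingHom f g (fun {s w} => h s w)

theorem lift_of {R : Type*} [Semiring R] (f : Poly n →+* R) (g : W →* R)
    (h : ∀ (s : Poly n) (w : W), f (w • s) * g w = g w * f s) (s : Poly n) (w : W) :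
    lift f g h (of s w) = f s * g w :=
  SkewMonoidAlgebra.liftNC_single (f : Poly n →+ R) g w s

end

end Skew

/-- The homogeneous part `(S * W)_i = S_i ⊗ ℂW`. -/
def skewGrade (n : ℕ) (W : Type*) [Group W] [MulSemiringAction W (Poly n)]
    [SMulCommClass W ℂ (Poly n)] (i : ℤ) : Submodule ℂ (Skew n W) where
  carrier := {a | ∀ w, a.coeff w ∈ polyGrade n i}
  add_mem' := fun ha hb w => by
    rw [Skew.coeff_add]; exact (polyGrade n i).add_mem (ha w) (hb w)
  zero_mem' := fun w => by
    rw [Skew.coeff_zero]; exact (polyGrade n i).zero_mem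
  smul_mem' := fun c a ha w => by
    rw [Skew.coeff_smul]; exact (polyGrade n i).smul_mem c (ha w)

/-- The ideal `S · R_{>0}` of `S` generated by the homogeneous invariants of positive degree, where
`R = S^W`. -/
def invariantIdeal (n : ℕ) (W : Type*) [Group W] [MulSemiringAction W (Poly n)] :
    Ideal (Poly n) :=
  Ideal.span {p | (∀ w : W, w • p = p) ∧ ∃ i : ℤ, 0 < i ∧ p ∈ polyGrade n i}

/-! ### Graded modules over the skew group algebra -/

/-- A graded left module over `S * W`. -/
structure GMod (n : ℕ) (W : Type*) [Group W] [MulSemiringAction W (Poly n)]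
    [SMulCommClass W ℂ (Poly n)] where
  carrier : Type
  [addCommGroup : AddCommGroup carrier]
  [moduleC : Module ℂ carrier]
  [moduleA : Module (Skew n W) carrier]
  [tower : IsScalarTower ℂ (Skew n W) carrier]
  /-- the homogeneous parts -/
  deg : ℤ → Submodule ℂ carrier
  internal : DirectSum.IsInternal deg
  smul_mem : ∀ (i j : ℤ) (a : Skew n W) (m : carrier),
    a ∈ skewGrade n W i → m ∈ deg j → a • m ∈ deg (i + j)

attribute [instance] GMod.addCommGroup GMod.moduleC GMod.moduleA GMod.tower

variable {n : ℕ} {W : Type*} [Group W] [MulSemiringAction W (Poly n)]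
  [SMulCommClass W ℂ (Poly n)]

theorem of_mem_skewGrade (w : W) {i : ℤ} {s : Poly n} (hs : s ∈ polyGrade n i) :
    (Skew.of s w : Skew n W) ∈ skewGrade n W i := by
  intro v
  by_cases h : w = v
  · subst h
    rw [Skew.coeff_of_same]; exact hs
  · rw [Skew.coeff_of_ne _ h]; exact (polyGrade n i).zero_mem

theorem one_mem_polyGrade : (1 : Poly n) ∈ polyGrade n 0 :=
  MvPolynomial.isWeightedHomogeneous_one ℂ _

namespace GMod

instance smulComm (M : GMod n W) : SMulCommClass (Skew n W) ℂ M.carrier :=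
  IsScalarTower.to_smulCommClass'

/-- The homogeneous component of degree `i` of an element. -/
def proj (M : GMod n W) (i : ℤ) : M.carrier →ₗ[ℂ] M.carrier := internalProj M.internal i

/-- The space `Hom_A(M, N)_d` of `A`-linear maps of degree `d`, where `A = S * W`. -/
def Hom (M N : GMod n W) (d : ℤ) : Submodule ℂ (M.carrier →ₗ[Skew n W] N.carrier) where
  carrier := {f | ∀ i, ∀ m ∈ M.deg i, f m ∈ N.deg (i + d)}
  add_mem' := fun hf hg i m hm => (N.deg (i + d)).add_mem (hf i m hm) (hg i m hm)
  zero_mem' := fun i _ _ => (N.deg (i + d)).zero_mem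
  smul_mem' := fun c _ hf i m hm => (N.deg (i + d)).smul_mem c (hf i m hm)

theorem proj_comm {M N : GMod n W} {d : ℤ} {f : M.carrier →ₗ[Skew n W] N.carrier}
    (hf : f ∈ Hom M N d) (i : ℤ) (x : M.carrier) : N.proj (i + d) (f x) = f (M.proj i x) := by
  have hx : x ∈ (⨆ j, M.deg j) := by
    rw [M.internal.submodule_iSup_eq_top]; trivial
  induction hx using Submodule.iSup_induction' with
  | mem j x hx =>
    by_cases hij : i = j
    · subst hij
      rw [proj, proj, internalProj_same _ _ _ hx, internalProj_same _ _ _ (hf i x hx)]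
    · rw [proj, proj, internalProj_ne _ _ _ hij _ hx, map_zero,
        internalProj_ne _ _ (j + d) (by omega) _ (hf j x hx)]
  | zero => simp
  | add x y _ _ hx hy => simp only [map_add, hx, hy]

/-- Isomorphism of graded modules (by maps of degree `0`). -/
def Iso (M N : GMod n W) : Prop :=
  ∃ e : M.carrier ≃ₗ[Skew n W] N.carrier, ∀ (i : ℤ) (m : M.carrier), m ∈ M.deg i ↔ e m ∈ N.deg i

/-- The graded module `M⟨d⟩`, with `(M⟨d⟩)_i = M_{i-d}`. -/
def shift (M : GMod n W) (d : ℤ) : GMod n W where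
  carrier := M.carrier
  deg := fun i => M.deg (i - d)
  internal := by
    refine isInternal_of_proj _ (fun i => M.proj (i - d)) (fun i m hm => ?_)
      (fun i j hij m hm => ?_) ?_
    · exact internalProj_same _ _ _ hm
    · exact internalProj_ne _ _ _ (by omega) _ hm
    · rw [← M.internal.submodule_iSup_eq_top]
      exact (Equiv.subRight d).iSup_comp (g := M.deg)
  smul_mem := fun i j a m ha hm => by
    rw [add_sub_assoc]
    exact M.smul_mem i (j - d) a m ha hm

/-- A submodule is graded if it contains the homogeneous components of its elements. -/
def IsGradedSub (M : GMod n W) (N : Submodule (Skew n W) M.carrier) : Prop :=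
  ∀ i, ∀ x ∈ N, M.proj i x ∈ N

/-- The projection onto the degree `i` part, restricted to a graded submodule. -/
def subProj (M : GMod n W) (N : Submodule (Skew n W) M.carrier) (hN : M.IsGradedSub N) (i : ℤ) :
    N →ₗ[ℂ] N where
  toFun x := ⟨M.proj i x, hN i x x.2⟩
  map_add' x y := Subtype.ext (map_add (M.proj i) (x : M.carrier) y)
  map_smul' c x := Subtype.ext (map_smul (M.proj i) c (x : M.carrier))

/-- The homogeneous parts `N_i = N ∩ M_i` of a submodule. -/
def subDeg (M : GMod n W) (N : Submodule (Skew n W) M.carrier) (i : ℤ) : Submodule ℂ N :=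
  (M.deg i).comap (N.subtype.restrictScalars ℂ)

theorem mem_subDeg {M : GMod n W} {N : Submodule (Skew n W) M.carrier} {i : ℤ} {x : N} :
    x ∈ M.subDeg N i ↔ (x : M.carrier) ∈ M.deg i := Iff.rfl

theorem subDeg_internal (M : GMod n W) (N : Submodule (Skew n W) M.carrier)
    (hN : M.IsGradedSub N) : DirectSum.IsInternal (M.subDeg N) := by
  refine isInternal_of_proj _ (M.subProj N hN) (fun i m hm => ?_) (fun i j hij m hm => ?_) ?_
  · exact Subtype.ext (internalProj_same M.internal i m (mem_subDeg.mp hm))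
  · exact Subtype.ext (internalProj_ne M.internal i j hij m (mem_subDeg.mp hm))
  · rw [eq_top_iff]
    intro x _
    obtain ⟨s, hs⟩ := exists_sum_internalProj M.internal (x : M.carrier)
    have : x = ∑ i ∈ s, M.subProj N hN i x := by
      apply Subtype.ext
      rw [AddSubmonoidClass.coe_finsetSum]
      exact hs.symm
    rw [this]
    refine Submodule.sum_mem _ fun i _ => ?_
    exact Submodule.mem_iSup_of_mem i
      (mem_subDeg.mpr (internalProj_mem M.internal i (x : M.carrier)))

/-- A graded submodule, as a graded module. -/
def sub (M : GMod n W) (N : Submodule (Skew n W) M.carrier) (hN : M.IsGradedSub N) :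
    GMod n W where
  carrier := N
  deg := M.subDeg N
  internal := M.subDeg_internal N hN
  smul_mem := fun i j a m ha hm =>
    mem_subDeg.mpr (M.smul_mem i j a (m : M.carrier) ha (mem_subDeg.mp hm))

/-- The quotient by a graded submodule: `(M/N)_i` is the image of `M_i`. -/
def quot (M : GMod n W) (N : Submodule (Skew n W) M.carrier) (hN : M.IsGradedSub N) :
    GMod n W where
  carrier := M.carrier ⧸ N
  deg := fun i => (M.deg i).map (N.mkQ.restrictScalars ℂ)
  internal := by
    refine isInternal_of_proj _
      (fun i => (N.restrictScalars ℂ).mapQ (N.restrictScalars ℂ) (M.proj i) (fun x hx => hN i x hx))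
      ?_ ?_ ?_
    · rintro i _ ⟨m, hm, rfl⟩
      exact congrArg N.mkQ (internalProj_same M.internal i m hm)
    · rintro i j hij _ ⟨m, hm, rfl⟩
      exact (congrArg N.mkQ (internalProj_ne M.internal i j hij m hm)).trans (map_zero _)
    · rw [← Submodule.map_iSup, M.internal.submodule_iSup_eq_top, Submodule.map_top,
        LinearMap.range_eq_top]
      exact N.mkQ_surjective
  smul_mem := by
    rintro i j a _ ha ⟨m, hm, rfl⟩
    exact ⟨a • m, M.smul_mem i j a m ha hm, rfl⟩

theorem isGradedSub_submoduleOf (M : GMod n W) (N N' : Submodule (Skew n W) M.carrier)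
    (hN : M.IsGradedSub N) (hN' : M.IsGradedSub N') :
    (M.sub N hN).IsGradedSub (N'.submoduleOf N) := by
  intro i x hx
  have h := proj_comm (M := M.sub N hN) (N := M) (d := 0) (f := N.subtype)
    (fun j m hm => by rw [add_zero]; exact hm) i x
  rw [add_zero] at h
  have h' : M.proj i (N.subtype x) ∈ N' := hN' i _ hx
  have h'' : N.subtype ((M.sub N hN).proj i x) ∈ N' := h ▸ h'
  exact h''

theorem isGradedSub_range {M N : GMod n W} {d : ℤ} {f : M.carrier →ₗ[Skew n W] N.carrier}
    (hf : f ∈ Hom M N d) : N.IsGradedSub (LinearMap.range f) := by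
  rintro i _ ⟨x, rfl⟩
  refine ⟨M.proj (i - d) x, ?_⟩
  rw [← proj_comm hf, sub_add_cancel]

theorem isGradedSub_iSup (M : GMod n W) {ι : Sort*} (N : ι → Submodule (Skew n W) M.carrier)
    (hN : ∀ k, M.IsGradedSub (N k)) : M.IsGradedSub (⨆ k, N k) := by
  intro i x hx
  induction hx using Submodule.iSup_induction' with
  | mem k x hx => exact Submodule.mem_iSup_of_mem k (hN k i x hx)
  | zero => rw [map_zero]; exact Submodule.zero_mem _
  | add x y _ _ hx hy => rw [map_add]; exact Submodule.add_mem _ hx hy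

/-- `M` is bounded below. -/
class BoundedBelow (M : GMod n W) : Prop where
  exists_bound : ∃ N : ℤ, ∀ i < N, M.deg i = ⊥

instance (M : GMod n W) [h : M.BoundedBelow] (N : Submodule (Skew n W) M.carrier)
    (hN : M.IsGradedSub N) : (M.quot N hN).BoundedBelow where
  exists_bound := by
    obtain ⟨b, hb⟩ := h.exists_bound
    refine ⟨b, fun i hi => ?_⟩
    change (M.deg i).map _ = ⊥
    rw [hb i hi, Submodule.map_bot]

/-- The representation of `W` on the homogeneous part `M_i`. -/
def rep (M : GMod n W) (i : ℤ) : Representation ℂ W (M.deg i) where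
  toFun w :=
    { toFun := fun m => ⟨(Skew.of 1 w : Skew n W) • (m : M.carrier), by
        have := M.smul_mem 0 i _ _ (of_mem_skewGrade w one_mem_polyGrade) m.2
        rwa [zero_add] at this⟩
      map_add' := fun x y => Subtype.ext (smul_add _ _ _)
      map_smul' := fun c x => Subtype.ext (smul_comm _ c (x : M.carrier)) }
  map_one' := by
    ext m
    exact one_smul (Skew n W) (m : M.carrier)
  map_mul' v w := by
    ext m
    change (Skew.of 1 (v * w) : Skew n W) • (m : M.carrier) =
      (Skew.of 1 v : Skew n W) • ((Skew.of 1 w : Skew n W) • (m : M.carrier))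
    rw [smul_smul, Skew.of_mul_of, smul_one, one_mul]

end GMod

/-! ### The graded modules `P_V = S ⊗ V` -/

section Free

variable {V : Type} [AddCommGroup V] [Module ℂ V]

/-- The action of `S * W` on `S ⊗ V`: `(s ⊗ w)(p ⊗ v) = s w(p) ⊗ w v`. -/
def freeAction (n : ℕ) [MulSemiringAction W (Poly n)] [SMulCommClass W ℂ (Poly n)]
    (ρ : Representation ℂ W V) : Skew n W →+* Module.End ℂ (Poly n ⊗[ℂ] V) :=
  Skew.lift
    (Module.toModuleEnd ℂ (S := Poly n) (Poly n ⊗[ℂ] V))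
    { toFun := fun w => TensorProduct.map (DistribSMul.toLinearMap ℂ (Poly n) w) (ρ w)
      map_one' := by ext; simp
      map_mul' := fun v w => by ext; simp [mul_smul] }
    (by
      intro x w
      ext p v
      simp [TensorProduct.smul_tmul'])

theorem freeAction_of (ρ : Representation ℂ W V) (w : W) (s p : Poly n) (v : V) :
    freeAction n ρ (Skew.of s w) (p ⊗ₜ v) = (s * w • p) ⊗ₜ ρ w v := by
  rw [freeAction, Skew.lift_of]
  simp [TensorProduct.smul_tmul']

/-- The projection of `S` onto `S_i`. -/
def polyProj (n : ℕ) (i : ℤ) : Poly n →ₗ[ℂ] Poly n :=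
  MvPolynomial.weightedHomogeneousComponent (fun _ : Fin n => (1 : ℤ)) i

variable [PreservesGrading n W]

/-- The graded module `P_V = S ⊗ V`, with `(P_V)_i = S_i ⊗ V`. -/
def freeGMod (n : ℕ) [MulSemiringAction W (Poly n)] [SMulCommClass W ℂ (Poly n)]
    [PreservesGrading n W] (ρ : Representation ℂ W V) : GMod n W where
  carrier := Poly n ⊗[ℂ] V
  moduleA := Module.compHom _ (freeAction n ρ)
  tower := by
    let _ : Module (Skew n W) (Poly n ⊗[ℂ] V) := Module.compHom _ (freeAction n ρ)
    refine ⟨fun c a x => ?_⟩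
    change freeAction n ρ (c • a) x = c • freeAction n ρ a x
    induction a using Skew.induction with
    | zero => simp
    | of s w =>
      rw [Skew.smul_of]
      induction x using TensorProduct.induction_on with
      | zero => simp
      | tmul p v =>
        rw [freeAction_of, freeAction_of, smul_mul_assoc, TensorProduct.smul_tmul']
      | add x y hx hy => rw [map_add, map_add, smul_add, hx, hy]
    | add a b ha hb => rw [smul_add, map_add, map_add, LinearMap.add_apply, LinearMap.add_apply,
        smul_add, ha, hb]
  deg := fun i => LinearMap.range ((polyGrade n i).subtype.rTensor V)
  internal := by
    refine isInternal_of_proj _ (fun i => (polyProj n i).rTensor V) ?_ ?_ ?_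
    · rintro i _ ⟨x, rfl⟩
      rw [← LinearMap.comp_apply, ← LinearMap.rTensor_comp]
      congr 2
      ext p : 1
      exact MvPolynomial.IsWeightedHomogeneous.weightedHomogeneousComponent_same p.2
    · rintro i j hij _ ⟨x, rfl⟩
      rw [← LinearMap.comp_apply, ← LinearMap.rTensor_comp]
      have : polyProj n i ∘ₗ (polyGrade n j).subtype = 0 := by
        ext p : 1
        exact MvPolynomial.IsWeightedHomogeneous.weightedHomogeneousComponent_ne i p.2 hij
      rw [this, LinearMap.rTensor_zero, LinearMap.zero_apply]
    · rw [eq_top_iff]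
      intro x _
      induction x using TensorProduct.induction_on with
      | zero => exact Submodule.zero_mem _
      | add x y hx hy => exact Submodule.add_mem _ (hx trivial) (hy trivial)
      | tmul p v =>
        have hp : p ∈ ⨆ i, polyGrade n i := by
          rw [MvPolynomial.as_sum p]
          refine Submodule.sum_mem _ fun m _ => ?_
          exact Submodule.mem_iSup_of_mem (Finsupp.weight (fun _ : Fin n => (1 : ℤ)) m)
            (MvPolynomial.isWeightedHomogeneous_monomial _ _ _ rfl)
        induction hp using Submodule.iSup_induction' with
        | mem i p hp => exact Submodule.mem_iSup_of_mem i ⟨⟨p, hp⟩ ⊗ₜ v, rfl⟩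
        | zero => rw [TensorProduct.zero_tmul]; exact Submodule.zero_mem _
        | add p q _ _ hp hq =>
          rw [TensorProduct.add_tmul]; exact Submodule.add_mem _ (hp trivial) (hq trivial)
  smul_mem := by
    rintro i j a _ ha ⟨x, rfl⟩
    change freeAction n ρ a _ ∈ _
    obtain ⟨t, ht⟩ := Skew.exists_sum_of a
    rw [ht, map_sum, LinearMap.sum_apply]
    refine Submodule.sum_mem _ fun w _ => ?_
    induction x using TensorProduct.induction_on with
    | zero => rw [map_zero, map_zero]; exact Submodule.zero_mem _
    | add x y hx hy => rw [map_add, map_add]; exact Submodule.add_mem _ hx hy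
    | tmul p v =>
      rw [LinearMap.rTensor_tmul, freeAction_of]
      exact ⟨⟨_, MvPolynomial.IsWeightedHomogeneous.mul (ha w)
        (PreservesGrading.smul_mem w j _ p.2)⟩ ⊗ₜ ρ w v, rfl⟩

/-- Multiplication by an invariant polynomial commutes with the action of `S * W`. -/
theorem mulLeft_freeAction (ρ : Representation ℂ W V) (r : Poly n) (hr : ∀ w : W, w • r = r)
    (a : Skew n W) (x : Poly n ⊗[ℂ] V) :
    (LinearMap.mulLeft ℂ r).rTensor V (freeAction n ρ a x) =
      freeAction n ρ a ((LinearMap.mulLeft ℂ r).rTensor V x) := by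
  induction a using Skew.induction with
  | zero => simp
  | of s w =>
    induction x using TensorProduct.induction_on with
    | zero => simp
    | tmul p v =>
      rw [LinearMap.rTensor_tmul, freeAction_of, freeAction_of, LinearMap.rTensor_tmul,
        LinearMap.mulLeft_apply, LinearMap.mulLeft_apply, smul_mul', hr, mul_left_comm]
    | add x y hx hy => simp only [map_add, hx, hy]
  | add a b ha hb => simp only [map_add, LinearMap.add_apply, ha, hb]

/-- Multiplication by an invariant polynomial, as an endomorphism of `P_V`. -/
def invMul (ρ : Representation ℂ W V) (r : Poly n) (hr : ∀ w : W, w • r = r) :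
    (freeGMod n ρ).carrier →ₗ[Skew n W] (freeGMod n ρ).carrier where
  toFun x := (LinearMap.mulLeft ℂ r).rTensor V x
  map_add' x y := map_add ((LinearMap.mulLeft ℂ r).rTensor V) x y
  map_smul' a x := mulLeft_freeAction ρ r hr a x

theorem invMul_mem (ρ : Representation ℂ W V) (r : Poly n) (hr : ∀ w : W, w • r = r) (d : ℤ)
    (hd : r ∈ polyGrade n d) :
    invMul ρ r hr ∈ GMod.Hom (freeGMod n ρ) (freeGMod n ρ) d := by
  rintro i _ ⟨x, rfl⟩
  change (LinearMap.mulLeft ℂ r).rTensor V ((polyGrade n i).subtype.rTensor V x) ∈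
    LinearMap.range ((polyGrade n (i + d)).subtype.rTensor V)
  induction x using TensorProduct.induction_on with
  | zero => rw [map_zero, map_zero]; exact Submodule.zero_mem _
  | add x y hx hy => rw [map_add, map_add]; exact Submodule.add_mem _ hx hy
  | tmul p v =>
    have : r * (p : Poly n) ∈ polyGrade n (i + d) := by
      rw [add_comm]
      exact MvPolynomial.IsWeightedHomogeneous.mul hd p.2
    exact ⟨⟨_, this⟩ ⊗ₜ v, rfl⟩

/-- A quotient of `P_V` is finite-dimensional if it kills the images of the multiplications by the
homogeneous invariants of positive degree. -/
theorem finiteDimensional_quotient [FiniteDimensional ℂ (Poly n ⧸ invariantIdeal n W)]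
    [FiniteDimensional ℂ V] (ρ : Representation ℂ W V)
    (T : Submodule (Skew n W) (freeGMod n ρ).carrier)
    (hT : ∀ (r : Poly n) (hr : ∀ w : W, w • r = r) (d : ℤ), 0 < d → r ∈ polyGrade n d →
      LinearMap.range (invMul ρ r hr) ≤ T) :
    FiniteDimensional ℂ ((freeGMod n ρ).carrier ⧸ T) := by
  have hI : ∀ p ∈ invariantIdeal n W, ∀ v : V, (p ⊗ₜ[ℂ] v : Poly n ⊗[ℂ] V) ∈ T := by
    intro p hp v
    induction hp using Submodule.span_induction with
    | mem r hr =>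
      obtain ⟨hr, d, hd, hrd⟩ := hr
      refine hT r hr d hd hrd ⟨(1 : Poly n) ⊗ₜ[ℂ] v, ?_⟩
      change (r * 1) ⊗ₜ[ℂ] v = r ⊗ₜ[ℂ] v
      rw [mul_one]
    | zero => rw [TensorProduct.zero_tmul]; exact T.zero_mem
    | add p q _ _ hp hq => rw [TensorProduct.add_tmul]; exact T.add_mem hp hq
    | smul s p _ hp =>
      have h1 : freeAction n ρ (Skew.of s 1) (p ⊗ₜ[ℂ] v) = (s • p) ⊗ₜ[ℂ] v := by
        rw [freeAction_of, one_smul, map_one]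
        rfl
      rw [← h1]
      exact T.smul_mem (Skew.of s 1) hp
  let I : Submodule ℂ (Poly n) := (invariantIdeal n W).restrictScalars ℂ
  have : FiniteDimensional ℂ (Poly n ⧸ I) :=
    inferInstanceAs (FiniteDimensional ℂ (Poly n ⧸ invariantIdeal n W))
  let q : Poly n ⊗[ℂ] V →ₗ[ℂ] (Poly n ⧸ I) ⊗[ℂ] V := I.mkQ.rTensor V
  let g : Poly n ⊗[ℂ] V →ₗ[ℂ] (freeGMod n ρ).carrier ⧸ T := T.mkQ.restrictScalars ℂ
  have hq : Function.Surjective q := LinearMap.rTensor_surjective V I.mkQ_surjective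
  have hker : LinearMap.ker q ≤ LinearMap.ker g := by
    have hex : Function.Exact (I.subtype.rTensor V) q :=
      rTensor_exact V (LinearMap.exact_subtype_mkQ I) I.mkQ_surjective
    rw [LinearMap.exact_iff.mp hex]
    rintro _ ⟨x, rfl⟩
    induction x using TensorProduct.induction_on with
    | zero => rw [map_zero]; exact Submodule.zero_mem _
    | add x y hx hy => rw [map_add]; exact Submodule.add_mem _ hx hy
    | tmul p v => exact (Submodule.Quotient.mk_eq_zero T).mpr (hI p p.2 v)
  have : FiniteDimensional ℂ ((Poly n ⊗[ℂ] V) ⧸ LinearMap.ker q) :=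
    Module.Finite.equiv (q.quotKerEquivOfSurjective hq).symm
  refine Module.Finite.of_surjective ((LinearMap.ker q).liftQ g hker) ?_
  intro y
  obtain ⟨x, rfl⟩ := T.mkQ_surjective y
  exact ⟨(LinearMap.ker q).mkQ x, rfl⟩

theorem polyGrade_neg (i : ℤ) (hi : i < 0) : polyGrade n i = ⊥ := by
  rw [eq_bot_iff]
  intro p hp
  rw [Submodule.mem_bot]
  by_contra hne
  obtain ⟨m, hm⟩ := MvPolynomial.ne_zero_iff.mp hne
  have h := hp hm
  have h' : (0 : ℤ) ≤ Finsupp.weight (fun _ : Fin n => (1 : ℤ)) m := by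
    rw [Finsupp.weight_apply]
    exact Finset.sum_nonneg fun _ _ => by simp
  omega

instance (ρ : Representation ℂ W V) : (freeGMod n ρ).BoundedBelow where
  exists_bound := by
    refine ⟨0, fun i hi => ?_⟩
    change LinearMap.range ((polyGrade n i).subtype.rTensor V) = ⊥
    have : (polyGrade n i).subtype = 0 := by
      ext p : 1
      exact (Submodule.mem_bot ℂ).mp ((polyGrade_neg (n := n) i hi).le p.2)
    rw [this, LinearMap.rTensor_zero, LinearMap.range_zero]

end Free

/-! ### Duals of finite-dimensional graded modules -/

/-- The transpose on `Hom_ℂ(M, ℂ)` of the action of an element of `S * W` on `M`. -/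
def transposeAction (M : GMod n W) (a : Skew n W) : Module.End ℂ (Module.Dual ℂ M.carrier) :=
  (Module.toModuleEnd ℂ (S := Skew n W) M.carrier a).dualMap

theorem transposeAction_apply (M : GMod n W) (a : Skew n W) (f : Module.Dual ℂ M.carrier)
    (m : M.carrier) : transposeAction M a f m = f (a • m) := rfl

theorem transposeAction_mul (M : GMod n W) (a b : Skew n W) :
    transposeAction M (a * b) = transposeAction M b * transposeAction M a := by
  ext f m
  rw [transposeAction_apply, mul_smul]
  rfl

/-- The action of `S * W` on `Hom_ℂ(M, ℂ)`: `((s ⊗ w) f)(m) = f ((w⁻¹(s) ⊗ w⁻¹) m)`. -/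
def dualAction (M : GMod n W) : Skew n W →+* Module.End ℂ (Module.Dual ℂ M.carrier) :=
  Skew.lift
    { toFun := fun s => transposeAction M (Skew.of s 1)
      map_one' := by
        ext f m
        rw [← Skew.one_def, transposeAction_apply, one_smul]; rfl
      map_mul' := fun s t => by
        rw [← transposeAction_mul, Skew.of_mul_of, one_smul, one_mul, mul_comm]
      map_zero' := by
        ext f m
        rw [Skew.of_zero, transposeAction_apply, zero_smul, map_zero]; rfl
      map_add' := fun s t => by
        ext f m
        rw [Skew.of_add, transposeAction_apply, add_smul, map_add]; rfl }
    { toFun := fun w => transposeAction M (Skew.of 1 w⁻¹)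
      map_one' := by
        ext f m
        rw [inv_one, ← Skew.one_def, transposeAction_apply, one_smul]; rfl
      map_mul' := fun v w => by
        rw [← transposeAction_mul, Skew.of_mul_of, smul_one, one_mul, mul_inv_rev] }
    (fun s w => by
      change transposeAction M (Skew.of (w • s) 1) * transposeAction M (Skew.of 1 w⁻¹) =
        transposeAction M (Skew.of 1 w⁻¹) * transposeAction M (Skew.of s 1)
      rw [← transposeAction_mul, ← transposeAction_mul, Skew.of_mul_of, Skew.of_mul_of,
        inv_smul_smul, one_mul, smul_one, mul_one, one_mul, mul_one])

theorem dualAction_of (M : GMod n W) (w : W) (s : Poly n) (f : Module.Dual ℂ M.carrier)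
    (m : M.carrier) :
    dualAction M (Skew.of s w) f m = f ((Skew.of (w⁻¹ • s) w⁻¹ : Skew n W) • m) := by
  have : (Skew.of (w⁻¹ • s) w⁻¹ : Skew n W) = Skew.of 1 w⁻¹ * Skew.of s 1 := by
    rw [Skew.of_mul_of, one_mul, mul_one]
  rw [this, mul_smul, dualAction, Skew.lift_of]
  rfl

/-- The dual `M^* = Hom_ℂ(M, ℂ)` of a finite-dimensional graded module, with
`(M^*)_i = Hom_ℂ(M_{-i}, ℂ)`, that is, the functionals that vanish on `M_j` for `j ≠ -i`. -/
def GMod.dual [PreservesGrading n W] (M : GMod n W) [FiniteDimensional ℂ M.carrier] :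
    GMod n W where
  carrier := Module.Dual ℂ M.carrier
  moduleA := Module.compHom _ (dualAction M)
  tower := by
    let _ : Module (Skew n W) (Module.Dual ℂ M.carrier) := Module.compHom _ (dualAction M)
    refine ⟨fun c a f => ?_⟩
    change dualAction M (c • a) f = c • dualAction M a f
    induction a using Skew.induction with
    | zero => simp
    | of s w =>
      ext m
      rw [Skew.smul_of, dualAction_of, LinearMap.smul_apply,
        dualAction_of, smul_comm, ← Skew.smul_of, smul_assoc, map_smul]
    | add a b ha hb => rw [smul_add, map_add, map_add, LinearMap.add_apply, LinearMap.add_apply,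
        smul_add, ha, hb]
  deg := fun i =>
    { carrier := {f | ∀ j, j ≠ -i → ∀ m ∈ M.deg j, f m = 0}
      add_mem' := fun hf hg j hj m hm => by
        rw [LinearMap.add_apply, hf j hj m hm, hg j hj m hm, add_zero]
      zero_mem' := fun _ _ _ _ => rfl
      smul_mem' := fun c f hf j hj m hm => by
        rw [LinearMap.smul_apply, hf j hj m hm, smul_zero] }
  internal := by
    have key : ∀ (i : ℤ) (f : Module.Dual ℂ M.carrier),
        ∀ j, j ≠ -i → ∀ m ∈ M.deg j, f (M.proj (-i) m) = 0 := by
      intro i f j hj m hm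
      rw [GMod.proj, internalProj_ne _ _ _ (Ne.symm hj) _ hm, map_zero]
    refine isInternal_of_proj _ (fun i => (M.proj (-i)).dualMap) ?_ ?_ ?_
    · intro i f hf
      ext m
      rw [LinearMap.dualMap_apply]
      have hx : m ∈ ⨆ j, M.deg j := by
        rw [M.internal.submodule_iSup_eq_top]; trivial
      induction hx using Submodule.iSup_induction' with
      | mem j m hm =>
        by_cases hj : j = -i
        · subst hj
          rw [GMod.proj, internalProj_same _ _ _ hm]
        · rw [key i f j hj m hm, hf j hj m hm]
      | zero => simp
      | add x y _ _ hx hy => simp only [map_add, hx, hy]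
    · intro i j hij f hf
      ext m
      rw [LinearMap.dualMap_apply]
      exact hf (-i) (by omega) _ (internalProj_mem _ _ _)
    · rw [eq_top_iff]
      intro f _
      have hfin : {i | M.deg i ≠ ⊥}.Finite :=
        WellFoundedGT.finite_ne_bot_of_iSupIndep M.internal.submodule_iSupIndep
      have hf : f = ∑ i ∈ hfin.toFinset, f ∘ₗ M.proj i := by
        ext m
        have hx : m ∈ ⨆ j, M.deg j := by
          rw [M.internal.submodule_iSup_eq_top]; trivial
        rw [LinearMap.sum_apply]
        induction hx using Submodule.iSup_induction' with
        | mem j m hm =>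
          by_cases hm0 : m = 0
          · simp [hm0]
          rw [Finset.sum_eq_single j]
          · rw [LinearMap.comp_apply, GMod.proj, internalProj_same _ _ _ hm]
          · intro k _ hk
            rw [LinearMap.comp_apply, GMod.proj, internalProj_ne _ _ _ hk _ hm, map_zero]
          · intro hj
            exfalso
            apply hj
            rw [Set.Finite.mem_toFinset]
            intro hbot
            rw [hbot, Submodule.mem_bot] at hm
            exact hm0 hm
        | zero => simp
        | add x y _ _ hx hy => simp only [map_add, hx, hy, Finset.sum_add_distrib]
      rw [hf]
      refine Submodule.sum_mem _ fun i _ => Submodule.mem_iSup_of_mem (-i) ?_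
      intro j hj m hm
      have := key (-i) f j hj m hm
      rw [neg_neg] at this
      exact this
  smul_mem := by
    intro i j a f ha hf
    change dualAction M a f ∈ _
    obtain ⟨t, ht⟩ := Skew.exists_sum_of a
    rw [ht, map_sum, LinearMap.sum_apply]
    refine Submodule.sum_mem _ fun w _ => ?_
    intro k hk m hm
    rw [dualAction_of]
    exact hf (i + k) (by omega) _ (M.smul_mem i k _ _
      (of_mem_skewGrade _ (PreservesGrading.smul_mem _ _ _ (ha w))) hm)

/-! ### Graded extension groups -/

/-- A projective object of the category of finitely generated graded modules. -/
def GMod.IsGProjective (P : GMod n W) : Prop :=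
  Module.Finite (Skew n W) P.carrier ∧
  ∀ (M N : GMod n W), Module.Finite (Skew n W) M.carrier → Module.Finite (Skew n W) N.carrier →
    ∀ f ∈ GMod.Hom M N 0, Function.Surjective f → ∀ g ∈ GMod.Hom P N 0,
      ∃ h ∈ GMod.Hom P M 0, f ∘ₗ h = g

/-- A projective resolution `⋯ → X 1 → X 0 → M → 0` in the category of finitely generated graded
modules. -/
structure GProjRes (M : GMod n W) where
  X : ℕ → GMod n W
  projective : ∀ i, (X i).IsGProjective
  d : ∀ i, (X (i + 1)).carrier →ₗ[Skew n W] (X i).carrier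
  d_mem : ∀ i, d i ∈ GMod.Hom (X (i + 1)) (X i) 0
  ε : (X 0).carrier →ₗ[Skew n W] M.carrier
  ε_mem : ε ∈ GMod.Hom (X 0) M 0
  surjective : Function.Surjective ε
  exact_zero : Function.Exact (d 0) ε
  exact_succ : ∀ i, Function.Exact (d (i + 1)) (d i)

namespace GProjRes

variable {M : GMod n W}

/-- The degree `i` cocycles of the complex `Hom_A(X_•, N)_d`, which is the complex of morphisms of
graded modules from `X_•` to `N⟨-d⟩`. -/
def cocycles (R : GProjRes M) (N : GMod n W) (i : ℕ) (d : ℤ) :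
    Submodule ℂ ((R.X i).carrier →ₗ[Skew n W] N.carrier) where
  carrier := {f | f ∈ GMod.Hom (R.X i) N d ∧ f ∘ₗ R.d i = 0}
  add_mem' := fun hf hg => ⟨Submodule.add_mem _ hf.1 hg.1, by
    rw [LinearMap.add_comp, hf.2, hg.2, add_zero]⟩
  zero_mem' := ⟨Submodule.zero_mem _, LinearMap.zero_comp _⟩
  smul_mem' := fun c f hf => ⟨Submodule.smul_mem _ c hf.1, by
    rw [LinearMap.smul_comp, hf.2, smul_zero]⟩

/-- The degree `i` coboundaries of the complex `Hom_A(X_•, N)_d`. -/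
def coboundaries (R : GProjRes M) (N : GMod n W) :
    (i : ℕ) → (d : ℤ) → Submodule ℂ ((R.X i).carrier →ₗ[Skew n W] N.carrier)
  | 0, _ => ⊥
  | i + 1, d =>
    { carrier := {f | ∃ g ∈ GMod.Hom (R.X i) N d, g ∘ₗ R.d i = f}
      add_mem' := by
        rintro _ _ ⟨g, hg, rfl⟩ ⟨g', hg', rfl⟩
        exact ⟨g + g', Submodule.add_mem _ hg hg', LinearMap.add_comp _ _ _⟩
      zero_mem' := ⟨0, Submodule.zero_mem _, LinearMap.zero_comp _⟩
      smul_mem' := by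
        rintro c _ ⟨g, hg, rfl⟩
        exact ⟨c • g, Submodule.smul_mem _ c hg, LinearMap.smul_comp _ _ _⟩ }

/-- The extension group `Ext^i_A(M, N)_d`, computed from the resolution `R` of `M`. -/
abbrev Ext (R : GProjRes M) (N : GMod n W) (i : ℕ) (d : ℤ) : Type :=
  (R.cocycles N i d) ⧸ (R.coboundaries N i d).submoduleOf (R.cocycles N i d)

end GProjRes

/-! ### Filtrations -/

/-- A separable filtration `M = M⁰ ⊇ M¹ ⊇ M² ⊇ ⋯` by graded submodules. -/
structure SepFiltration (M : GMod n W) where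
  N : ℕ → Submodule (Skew n W) M.carrier
  graded : ∀ i, M.IsGradedSub (N i)
  zero : N 0 = ⊤
  anti : ∀ i, N (i + 1) ≤ N i
  separable : ⨅ i, N i = ⊥

namespace SepFiltration

variable {M : GMod n W}

/-- The factor `Mⁱ / Mⁱ⁺¹`. -/
def factor (Φ : SepFiltration M) (i : ℕ) : GMod n W :=
  (M.sub (Φ.N i) (Φ.graded i)).quot ((Φ.N (i + 1)).submoduleOf (Φ.N i))
    (M.isGradedSub_submoduleOf _ _ (Φ.graded i) (Φ.graded (i + 1)))

/-- Every factor is zero or isomorphic to `F_α⟨d⟩` for some `α` and `d`. -/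
def IsFilteredBy {Λ : Type*} (Φ : SepFiltration M) (F : Λ → GMod n W) : Prop :=
  ∀ i, Subsingleton (Φ.factor i).carrier ∨ ∃ α d, (Φ.factor i).Iso ((F α).shift d)

/-- For every `α`, the multiplicity of `F_α` in the filtration is the formal Laurent series `f_α`:
the number of factors isomorphic to `F_α⟨d⟩` is finite and is the coefficient of `q ^ d`. -/
def HasMultiplicities {Λ : Type*} (Φ : SepFiltration M) (F : Λ → GMod n W) (f : Λ → ℤ⸨X⸩) : Prop :=
  ∀ α d, {i | (Φ.factor i).Iso ((F α).shift d)}.Finite ∧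
    ({i | (Φ.factor i).Iso ((F α).shift d)}.ncard : ℤ) = (f α).coeff d

end SepFiltration

/-! ### Irreducible representations and composition multiplicities -/

/-- An irreducible complex representation of `W`, on some `ℂ^dim`. -/
structure IrrRep (W : Type*) [Group W] where
  dim : ℕ
  rep : Representation ℂ W (Fin dim → ℂ)
  irreducible : rep.IsIrreducible

instance IrrRep.setoid (W : Type*) [Group W] : Setoid (IrrRep W) where
  r σ τ := Nonempty (σ.rep.Equiv τ.rep)
  iseqv := ⟨fun σ => ⟨.refl σ.rep⟩, fun ⟨e⟩ => ⟨e.symm⟩, fun ⟨e⟩ ⟨e'⟩ => ⟨e.trans e'⟩⟩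

/-- The set of isomorphism classes of irreducible complex representations of `W`. -/
def Irr (W : Type*) [Group W] : Type _ := Quotient (IrrRep.setoid W)

/-- A representative of an isomorphism class. -/
def Irr.out {W : Type*} [Group W] (lam : Irr W) : IrrRep W :=
  Quotient.out (s := IrrRep.setoid W) lam

/-- The irreducible representation belonging to an isomorphism class. -/
def Irr.rep {W : Type*} [Group W] (lam : Irr W) : Representation ℂ W (Fin lam.out.dim → ℂ) :=
  lam.out.rep

namespace GMod

/-- The multiplicity `[M_i : λ]` of `λ` in the `W`-representation `M_i`, that is, the dimension of
`Hom_W(λ, M_i)`. -/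
def mult (M : GMod n W) (lam : Irr W) (i : ℤ) : ℕ :=
  Module.finrank ℂ (Representation.IntertwiningMap lam.rep (M.rep i))

theorem mult_bddBelow (M : GMod n W) [h : M.BoundedBelow] (lam : Irr W) :
    BddBelow (Function.support fun i => (M.mult lam i : ℤ)) := by
  obtain ⟨b, hb⟩ := h.exists_bound
  refine ⟨b, fun i hi => ?_⟩
  by_contra hlt
  apply hi
  have hbot := hb i (not_le.mp hlt)
  have : Subsingleton (M.deg i) := by
    rw [hbot]; infer_instance
  have hs : Subsingleton (Representation.IntertwiningMap lam.rep (M.rep i)) :=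
    ⟨fun f g => DFunLike.ext f g fun x => Subsingleton.elim (f x) (g x)⟩
  change ((Module.finrank ℂ (Representation.IntertwiningMap lam.rep (M.rep i)) : ℕ) : ℤ) = 0
  rw [Module.finrank_zero_of_subsingleton, Nat.cast_zero]

/-- The graded multiplicity `[M : L_λ]_q = ∑ q ^ i [M_i : λ]`, a formal Laurent series. -/
def qmult (M : GMod n W) [M.BoundedBelow] (lam : Irr W) : ℤ⸨X⸩ :=
  HahnSeries.ofSuppBddBelow (fun i => (M.mult lam i : ℤ)) (M.mult_bddBelow lam)

end GMod

/-! ### Trace quotient modules -/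

variable [PreservesGrading n W]

/-- The projective module `P_λ = S ⊗ λ`. -/
def P (n : ℕ) [MulSemiringAction W (Poly n)] [SMulCommClass W ℂ (Poly n)] [PreservesGrading n W]
    (lam : Irr W) : GMod n W := freeGMod n lam.rep

instance (lam : Irr W) : (P n lam).BoundedBelow :=
  inferInstanceAs (freeGMod n lam.rep).BoundedBelow

/-- The sum of the images of all homomorphisms of positive degree from `P_μ` to `P_λ`, over all `μ`
with property `T`. -/
def traceSub (T : Irr W → Prop) (lam : Irr W) : Submodule (Skew n W) (P n lam).carrier :=
  ⨆ (mu : Irr W) (_ : T mu) (d : ℤ) (_ : 0 < d)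
    (f : (P n mu).carrier →ₗ[Skew n W] (P n lam).carrier) (_ : f ∈ GMod.Hom (P n mu) (P n lam) d),
    LinearMap.range f

theorem traceSub_graded (T : Irr W → Prop) (lam : Irr W) :
    (P n lam).IsGradedSub (traceSub T lam) := by
  refine GMod.isGradedSub_iSup _ _ fun mu => GMod.isGradedSub_iSup _ _ fun _ =>
    GMod.isGradedSub_iSup _ _ fun d => GMod.isGradedSub_iSup _ _ fun _ =>
    GMod.isGradedSub_iSup _ _ fun f => GMod.isGradedSub_iSup _ _ fun hf =>
    GMod.isGradedSub_range hf

variable [Preorder (Irr W)]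

/-- The trace quotient module `K_λ = P_λ / I_λ`, with `I_λ` the sum of the images of all
homomorphisms of positive degree from `P_μ` to `P_λ` with `λ ≤ μ`. -/
def K (n : ℕ) [MulSemiringAction W (Poly n)] [SMulCommClass W ℂ (Poly n)] [PreservesGrading n W]
    (lam : Irr W) : GMod n W :=
  (P n lam).quot (traceSub (fun mu => lam ≤ mu) lam) (traceSub_graded _ lam)

/-- The strict trace quotient module, defined like `K_λ` with `λ < μ` in place of `λ ≤ μ`. -/
def Ktilde (n : ℕ) [MulSemiringAction W (Poly n)] [SMulCommClass W ℂ (Poly n)]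
    [PreservesGrading n W] (lam : Irr W) : GMod n W :=
  (P n lam).quot (traceSub (fun mu => lam < mu) lam) (traceSub_graded _ lam)

instance (lam : Irr W) : (Ktilde n lam).BoundedBelow :=
  inferInstanceAs (GMod.quot (P n lam) (traceSub (fun mu => lam < mu) lam) _).BoundedBelow

instance [FiniteDimensional ℂ (Poly n ⧸ invariantIdeal n W)] (lam : Irr W) :
    FiniteDimensional ℂ (K n lam).carrier := by
  refine finiteDimensional_quotient lam.rep (traceSub (fun mu => lam ≤ mu) lam) ?_
  intro r hr d hd hrd
  exact le_iSup_of_le lam (le_iSup_of_le le_rfl (le_iSup_of_le d (le_iSup_of_le hd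
    (le_iSup_of_le (invMul lam.rep r hr) (le_iSup_of_le (invMul_mem lam.rep r hr d hrd) le_rfl)))))

/-! ### The three conditions -/

/-- The orthogonality condition: `Ext^i_A(K̃_λ, K_μ^*)_d` is `ℂ` if `i = d = 0` and `λ = μ`, and `0`
otherwise. The extension groups do not depend on the projective resolutions used. -/
def Orthogonality (n : ℕ) (W : Type*) [Group W] [MulSemiringAction W (Poly n)]
    [SMulCommClass W ℂ (Poly n)] [PreservesGrading n W] [Preorder (Irr W)]
    [FiniteDimensional ℂ (Poly n ⧸ invariantIdeal n W)] : Prop :=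
  ∀ lam : Irr W, ∃ R : GProjRes (Ktilde n lam), ∀ (mu : Irr W) (i : ℕ) (d : ℤ),
    (i = 0 ∧ d = 0 ∧ lam = mu → Nonempty (R.Ext (K n mu).dual i d ≃ₗ[ℂ] ℂ)) ∧
    (¬ (i = 0 ∧ d = 0 ∧ lam = mu) → Subsingleton (R.Ext (K n mu).dual i d))

/-- Every `P_λ` is filtered by the strict trace quotient modules. -/
def HasKtildeFiltrations (n : ℕ) (W : Type*) [Group W] [MulSemiringAction W (Poly n)]
    [SMulCommClass W ℂ (Poly n)] [PreservesGrading n W] [Preorder (Irr W)] : Prop :=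
  ∀ lam : Irr W, ∃ Φ : SepFiltration (P n lam), Φ.IsFilteredBy (Ktilde n (W := W))

/-- Every strict trace quotient module is filtered by the trace quotient modules. -/
def HasKFiltrations (n : ℕ) (W : Type*) [Group W] [MulSemiringAction W (Poly n)]
    [SMulCommClass W ℂ (Poly n)] [PreservesGrading n W] [Preorder (Irr W)] : Prop :=
  ∀ lam : Irr W, ∃ Φ : SepFiltration (Ktilde n lam), Φ.IsFilteredBy (K n (W := W))

/-- The matrix `[K̃ : L]` with entries `[K̃_λ : L_μ]_q`. -/
def KtildeL (n : ℕ) (W : Type*) [Group W] [MulSemiringAction W (Poly n)]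
    [SMulCommClass W ℂ (Poly n)] [PreservesGrading n W] [Preorder (Irr W)] :
    Matrix (Irr W) (Irr W) ℤ⸨X⸩ :=
  Matrix.of fun lam mu => (Ktilde n lam).qmult mu

end

end SkewK

open scoped TensorProduct LaurentSeries

namespace SkewK

noncomputable section

variable {n : ℕ} {W : Type*} [Group W] [MulSemiringAction W (Poly n)]
  [SMulCommClass W ℂ (Poly n)]

/-! ### Homogeneous components -/

/-! Both multiplicities are dimensions of spaces of contravariant bilinear forms. A form on `M × N`
satisfies `β((s ⊗ w) m, x) = β(m, (w⁻¹(s) ⊗ w⁻¹) x)`, and it has degree `d` if it pairs `M_i` with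
`N_j` only for `i + j = d`. Such forms are the maps from `M` to the dual of `N` when `N` is
finite-dimensional, but they make sense for infinite-dimensional `N` and are visibly symmetric in
`M` and `N` (`GMod.formFlip`).

By orthogonality the forms on `K̃_μ × K_α` have dimension 1 if `α = μ` and the degree is 0, and
dimension 0 otherwise. The vanishing of `Ext¹` makes the dimension additive along short exact
sequences in the second variable (`GProjRes.FormsLift.rank_form`). A filtration may be infinite, but
`K̃_μ` is bounded below, so a form of fixed degree kills everything in high degree and only finitely
many factors matter. Hence in every K-filtration of `M`, the number of factors `K_μ⟨d⟩` is the
dimension of the degree `d` forms on `K̃_μ × M` (`SepFiltration.ncard_eq_rank_form`).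

For `M = K̃_λ`, symmetry of the matrix is the interchange of the two variables. For `M = P_λ`, the
interchange and Frobenius reciprocity identify the forms with `Hom_W(λ, ((K̃_μ)_d)^*)`, and
self-duality of the representations of `W` turns this into `[(K̃_μ)_d : λ]` (`rank_form_P`).

A K-filtration of `P_λ` has to be extracted from a `K̃`-filtration whose factors have infinite
K-filtrations themselves. Naive refinement has order type `ω²`. Each K is finite-dimensional, so
finitely many steps of a later filtration can be moved in front of a high-degree tail of an earlier
one; a diagonal process then gives order type `ω` (`GMod.exists_step_of_converges`). -/

theorem iSup_skewGrade_eq_top : ⨆ i : ℕ, skewGrade n W i = ⊤ := by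
  rw [eq_top_iff]
  intro a _
  induction a using Skew.induction with
  | zero => exact Submodule.zero_mem _
  | add a b ha hb => exact Submodule.add_mem _ (ha trivial) (hb trivial)
  | of s w =>
    induction s using MvPolynomial.induction_on' with
    | monomial m c =>
      refine Submodule.mem_iSup_of_mem (m.degree) (of_mem_skewGrade w ?_)
      refine MvPolynomial.isWeightedHomogeneous_monomial _ _ _ ?_
      simp [Finsupp.weight_apply, Finsupp.degree_apply, Finsupp.sum]
    | add p q hp hq =>
      rw [Skew.of_add]
      exact Submodule.add_mem _ (hp trivial) (hq trivial)

namespace GMod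

theorem proj_mem (M : GMod n W) (i : ℤ) (x : M.carrier) : M.proj i x ∈ M.deg i :=
  internalProj_mem _ _ _

theorem proj_of_mem {M : GMod n W} {i : ℤ} {x : M.carrier} (hx : x ∈ M.deg i) : M.proj i x = x :=
  internalProj_same _ _ _ hx

theorem proj_of_mem_ne {M : GMod n W} {i j : ℤ} (h : i ≠ j) {x : M.carrier} (hx : x ∈ M.deg j) :
    M.proj i x = 0 :=
  internalProj_ne _ _ _ h _ hx

theorem exists_sum_proj (M : GMod n W) (x : M.carrier) :
    ∃ s : Finset ℤ, ∑ i ∈ s, M.proj i x = x :=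
  exists_sum_internalProj M.internal x

theorem hom_induction (M : GMod n W) {p : M.carrier → Prop} (zero : p 0)
    (mem : ∀ i, ∀ x ∈ M.deg i, p x) (add : ∀ x y, p x → p y → p (x + y)) (x : M.carrier) : p x := by
  have hx : x ∈ (⨆ j, M.deg j) := by
    rw [M.internal.submodule_iSup_eq_top]; trivial
  induction hx using Submodule.iSup_induction' with
  | mem i x hx => exact mem i x hx
  | zero => exact zero
  | add x y _ _ hx hy => exact add x y hx hy

theorem proj_smul (M : GMod n W) {j : ℤ} {a : Skew n W} (ha : a ∈ skewGrade n W j) (i : ℤ)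
    (y : M.carrier) : M.proj i (a • y) = a • M.proj (i - j) y := by
  induction y using M.hom_induction with
  | zero => simp
  | add x y hx hy => rw [smul_add, map_add, map_add, smul_add, hx, hy]
  | mem k y hy =>
    have := M.smul_mem j k a y ha hy
    by_cases h : i = j + k
    · subst h
      rw [proj_of_mem this, add_sub_cancel_left, proj_of_mem hy]
    · rw [proj_of_mem_ne h this, proj_of_mem_ne (by omega) hy, smul_zero]

theorem exists_mem_deg_of_surjective {M N : GMod n W} {d : ℤ}
    {f : M.carrier →ₗ[Skew n W] N.carrier} (hf : f ∈ Hom M N d) (hs : Function.Surjective f)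
    {i : ℤ} {y : N.carrier} (hy : y ∈ N.deg i) : ∃ x ∈ M.deg (i - d), f x = y := by
  obtain ⟨x, rfl⟩ := hs y
  refine ⟨M.proj (i - d) x, M.proj_mem _ _, ?_⟩
  rw [← proj_comm hf, sub_add_cancel, proj_of_mem hy]

theorem mem_deg_of_injective {M N : GMod n W} {d : ℤ}
    {f : M.carrier →ₗ[Skew n W] N.carrier} (hf : f ∈ Hom M N d) (hs : Function.Injective f)
    {i : ℤ} {x : M.carrier} (hx : f x ∈ N.deg (i + d)) : x ∈ M.deg i := by
  have : f (M.proj i x) = f x := by rw [← proj_comm hf, proj_of_mem hx]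
  rw [← hs this]
  exact M.proj_mem _ _

theorem iso_of_bijective {M N : GMod n W} {f : M.carrier →ₗ[Skew n W] N.carrier}
    (hf : f ∈ Hom M N 0) (hs : Function.Bijective f) : M.Iso N := by
  refine ⟨LinearEquiv.ofBijective f hs, fun i m => ⟨fun hm => ?_, fun hm => ?_⟩⟩
  · simpa using hf i m hm
  · exact mem_deg_of_injective hf hs.1 (by simpa using hm)

theorem finite_support_deg (M : GMod n W) [FiniteDimensional ℂ M.carrier] :
    {i | M.deg i ≠ ⊥}.Finite :=
  WellFoundedGT.finite_ne_bot_of_iSupIndep M.internal.submodule_iSupIndep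

theorem exists_deg_eq_bot (M : GMod n W) [FiniteDimensional ℂ M.carrier] :
    ∃ b : ℤ, ∀ i > b, M.deg i = ⊥ := by
  obtain ⟨b, hb⟩ := M.finite_support_deg.bddAbove
  refine ⟨b, fun i hi => ?_⟩
  by_contra h
  exact absurd (hb h) (not_le.mpr hi)

/-! ### Truncations -/

/-- The submodule of elements all of whose homogeneous components have degree greater than `D`. -/
def trunc (M : GMod n W) (D : ℤ) : Submodule (Skew n W) M.carrier where
  carrier := {m | ∀ i ≤ D, M.proj i m = 0}
  add_mem' := fun hx hy i hi => by rw [map_add, hx i hi, hy i hi, add_zero]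
  zero_mem' := fun i _ => map_zero _
  smul_mem' := by
    intro a x hx i hi
    -- The algebra lives in nonnegative degrees, so multiplication never lowers degrees; indexing by
    -- `ℕ` records this.
    have ha : a ∈ ⨆ i : ℕ, skewGrade n W i := by rw [iSup_skewGrade_eq_top]; trivial
    induction ha using Submodule.iSup_induction' with
    | zero => rw [zero_smul, map_zero]
    | add a b _ _ ha hb => rw [add_smul, map_add, ha, hb, add_zero]
    | mem j a ha =>
      rw [M.proj_smul ha, hx _ (by omega), smul_zero]

theorem mem_trunc_of_mem_deg {M : GMod n W} {D i : ℤ} (h : D < i) {x : M.carrier}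
    (hx : x ∈ M.deg i) : x ∈ M.trunc D :=
  fun _ hj => proj_of_mem_ne (by omega) hx

theorem trunc_anti (M : GMod n W) {D E : ℤ} (h : D ≤ E) : M.trunc E ≤ M.trunc D :=
  fun _ hx i hi => hx i (hi.trans h)

theorem isGradedSub_trunc (M : GMod n W) (D : ℤ) : M.IsGradedSub (M.trunc D) := by
  intro i x hx j hj
  by_cases h : j = i
  · subst h
    rw [proj_of_mem (M.proj_mem _ _), hx _ hj]
  · exact proj_of_mem_ne h (M.proj_mem _ _)

theorem isGradedSub_inf {M : GMod n W} {A B : Submodule (Skew n W) M.carrier}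
    (hA : M.IsGradedSub A) (hB : M.IsGradedSub B) : M.IsGradedSub (A ⊓ B) :=
  fun i x hx => ⟨hA i x hx.1, hB i x hx.2⟩

theorem isGradedSub_sup {M : GMod n W} {A B : Submodule (Skew n W) M.carrier}
    (hA : M.IsGradedSub A) (hB : M.IsGradedSub B) : M.IsGradedSub (A ⊔ B) := by
  intro i x hx
  obtain ⟨a, ha, b, hb, rfl⟩ := Submodule.mem_sup.mp hx
  rw [map_add]
  exact Submodule.add_mem_sup (hA i a ha) (hB i b hb)

theorem isGradedSub_top (M : GMod n W) : M.IsGradedSub ⊤ := fun _ _ _ => trivial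

theorem eq_zero_of_forall_mem_trunc {M : GMod n W} {x : M.carrier}
    (h : ∀ D, x ∈ M.trunc D) : x = 0 := by
  obtain ⟨s, hs⟩ := M.exists_sum_proj x
  rw [← hs]
  exact Finset.sum_eq_zero fun i _ => h i i le_rfl

/-! ### Subquotients -/

/-- The subquotient `A / (A ∩ B)` of a graded module. -/
def subquot (M : GMod n W) {A B : Submodule (Skew n W) M.carrier} (hA : M.IsGradedSub A)
    (hB : M.IsGradedSub B) : GMod n W :=
  (M.sub A hA).quot (B.submoduleOf A) (M.isGradedSub_submoduleOf A B hA hB)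

/-- The map from a graded submodule to a subquotient. -/
def toSubquot (M : GMod n W) {A B : Submodule (Skew n W) M.carrier} (hA : M.IsGradedSub A)
    (hB : M.IsGradedSub B) : A →ₗ[Skew n W] (M.subquot hA hB).carrier :=
  (B.submoduleOf A).mkQ

variable {M : GMod n W} {A B : Submodule (Skew n W) M.carrier} (hA : M.IsGradedSub A)
  (hB : M.IsGradedSub B)

theorem toSubquot_surjective : Function.Surjective (M.toSubquot hA hB) :=
  Submodule.mkQ_surjective _

theorem toSubquot_eq_zero {x : A} : M.toSubquot hA hB x = 0 ↔ (x : M.carrier) ∈ B :=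
  Submodule.Quotient.mk_eq_zero _

theorem toSubquot_mem : M.toSubquot hA hB ∈ Hom (M.sub A hA) (M.subquot hA hB) 0 := by
  intro i x hx
  rw [add_zero]
  exact ⟨x, hx, rfl⟩

theorem exists_of_mem_deg_subquot {i : ℤ} {y : (M.subquot hA hB).carrier}
    (hy : y ∈ (M.subquot hA hB).deg i) :
    ∃ x : A, (x : M.carrier) ∈ M.deg i ∧ M.toSubquot hA hB x = y := by
  obtain ⟨x, hx, rfl⟩ := hy
  exact ⟨x, hx, rfl⟩

theorem subsingleton_subquot_iff : Subsingleton (M.subquot hA hB).carrier ↔ A ≤ B := by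
  constructor
  · intro h x hx
    exact (toSubquot_eq_zero hA hB (x := ⟨x, hx⟩)).mp (Subsingleton.elim _ _)
  · intro h
    refine ⟨fun y z => ?_⟩
    obtain ⟨y, rfl⟩ := toSubquot_surjective hA hB y
    obtain ⟨z, rfl⟩ := toSubquot_surjective hA hB z
    rw [(toSubquot_eq_zero hA hB).mpr (h y.2), (toSubquot_eq_zero hA hB).mpr (h z.2)]

theorem deg_subquot_eq_bot {i : ℤ} (h : ∀ x ∈ A, x ∈ M.deg i → x ∈ B) :
    (M.subquot hA hB).deg i = ⊥ := by
  rw [eq_bot_iff]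
  intro y hy
  obtain ⟨x, hx, rfl⟩ := exists_of_mem_deg_subquot hA hB hy
  exact (toSubquot_eq_zero hA hB).mpr (h x x.2 hx)

/-- A linear map on a graded submodule that vanishes on `A ∩ B` factors through the subquotient. -/
theorem exists_subquot_lift {N : GMod n W} {d : ℤ} (f : A →ₗ[Skew n W] N.carrier)
    (hf : f ∈ Hom (M.sub A hA) N d) (h : ∀ x : A, (x : M.carrier) ∈ B → f x = 0) :
    ∃ g ∈ Hom (M.subquot hA hB) N d, ∀ x, g (M.toSubquot hA hB x) = f x := by
  refine ⟨(B.submoduleOf A).liftQ f (fun x hx => h x hx), ?_, fun x => rfl⟩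
  rintro i _ ⟨x, hx, rfl⟩
  exact hf i x hx

end GMod

/-! ### Contravariant bilinear forms -/

namespace GMod

/-- The space of bilinear forms `β` on `M × N` of degree `d` with
`β ((s ⊗ w) m) x = β m ((w⁻¹(s) ⊗ w⁻¹) x)`. -/
def form (M N : GMod n W) (d : ℤ) : Submodule ℂ (M.carrier →ₗ[ℂ] N.carrier →ₗ[ℂ] ℂ) where
  carrier := {β | (∀ (s : Poly n) (w : W) m x,
      β ((Skew.of s w : Skew n W) • m) x = β m ((Skew.of (w⁻¹ • s) w⁻¹ : Skew n W) • x)) ∧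
    ∀ i j, i + j ≠ d → ∀ m ∈ M.deg i, ∀ x ∈ N.deg j, β m x = 0}
  add_mem' := fun hf hg => ⟨fun s w m x => by
    simp only [LinearMap.add_apply, hf.1, hg.1], fun i j h m hm x hx => by
    simp only [LinearMap.add_apply, hf.2 i j h m hm x hx, hg.2 i j h m hm x hx, add_zero]⟩
  zero_mem' := ⟨fun _ _ _ _ => rfl, fun _ _ _ _ _ _ _ => rfl⟩
  smul_mem' := fun c f hf => ⟨fun s w m x => by
    simp only [LinearMap.smul_apply, hf.1], fun i j h m hm x hx => by
    simp only [LinearMap.smul_apply, hf.2 i j h m hm x hx, smul_zero]⟩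

/-- The twist `s ⊗ w ↦ w⁻¹(s) ⊗ w⁻¹` is an involution, so contravariance can be read from either
side. The symmetry of the matrix in the theorem rests on this. -/
theorem flip_mem_form {M N : GMod n W} {d : ℤ} {β : M.carrier →ₗ[ℂ] N.carrier →ₗ[ℂ] ℂ}
    (hβ : β ∈ form M N d) : β.flip ∈ form N M d := by
  refine ⟨fun s w m x => ?_, fun i j h m hm x hx => ?_⟩
  · rw [LinearMap.flip_apply, LinearMap.flip_apply, hβ.1, inv_inv, smul_inv_smul]
  · exact hβ.2 j i (by omega) x hx m hm

/-- Interchanging the variables. -/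
def formFlip (M N : GMod n W) (d : ℤ) : form M N d ≃ₗ[ℂ] form N M d where
  toFun β := ⟨β.1.flip, flip_mem_form β.2⟩
  invFun β := ⟨β.1.flip, flip_mem_form β.2⟩
  map_add' _ _ := rfl
  map_smul' _ _ := rfl
  left_inv _ := rfl
  right_inv _ := rfl

/-- The pullback of a bilinear form along a linear map in the second variable. -/
def pull (X : GMod n W) {M N : GMod n W} (f : M.carrier →ₗ[Skew n W] N.carrier) :
    (X.carrier →ₗ[ℂ] N.carrier →ₗ[ℂ] ℂ) →ₗ[ℂ] (X.carrier →ₗ[ℂ] M.carrier →ₗ[ℂ] ℂ) :=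
  LinearMap.llcomp ℂ X.carrier (N.carrier →ₗ[ℂ] ℂ) (M.carrier →ₗ[ℂ] ℂ)
    (f.restrictScalars ℂ).dualMap

theorem pull_apply (X : GMod n W) {M N : GMod n W} (f : M.carrier →ₗ[Skew n W] N.carrier)
    (β : X.carrier →ₗ[ℂ] N.carrier →ₗ[ℂ] ℂ) (x : X.carrier) (m : M.carrier) :
    pull X f β x m = β x (f m) := rfl

theorem pull_mem {X M N : GMod n W} {e d d' : ℤ} {f : M.carrier →ₗ[Skew n W] N.carrier}
    (hf : f ∈ Hom M N e) (h : d' = d + e) {β : X.carrier →ₗ[ℂ] N.carrier →ₗ[ℂ] ℂ}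
    (hβ : β ∈ form X N d') : pull X f β ∈ form X M d := by
  refine ⟨fun s w m x => ?_, fun i j hij m hm x hx => ?_⟩
  · rw [pull_apply, pull_apply, hβ.1, map_smul f]
  · exact hβ.2 i (j + e) (by omega) m hm _ (hf j x hx)

/-- The pullback of forms of a given degree. -/
def formPull (X : GMod n W) {M N : GMod n W} {e : ℤ} {f : M.carrier →ₗ[Skew n W] N.carrier}
    (hf : f ∈ Hom M N e) {d d' : ℤ} (h : d' = d + e) : form X N d' →ₗ[ℂ] form X M d :=
  (pull X f).restrict fun _ hβ => pull_mem hf h hβ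

theorem formPull_apply (X : GMod n W) {M N : GMod n W} {e : ℤ}
    {f : M.carrier →ₗ[Skew n W] N.carrier} (hf : f ∈ Hom M N e) {d d' : ℤ} (h : d' = d + e)
    (β : form X N d') (x : X.carrier) (m : M.carrier) :
    (formPull X hf h β).1 x m = β.1 x (f m) := rfl

/-- A form that vanishes on the kernel of a surjection descends along it. -/
theorem exists_form_descend {X M N : GMod n W} {e d d' : ℤ}
    {f : M.carrier →ₗ[Skew n W] N.carrier} (hf : f ∈ Hom M N e) (hs : Function.Surjective f)
    (h : d' = d + e) {β : X.carrier →ₗ[ℂ] M.carrier →ₗ[ℂ] ℂ} (hβ : β ∈ form X M d)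
    (h0 : ∀ x m, f m = 0 → β x m = 0) : ∃ γ ∈ form X N d', ∀ x m, γ x (f m) = β x m := by
  -- The section is only `ℂ`-linear. Since `β` vanishes on the kernel of `f`, the descended form
  -- does not depend on it, and contravariance and degree are inherited from `β`.
  obtain ⟨σ, hσ⟩ := (f.restrictScalars ℂ).exists_rightInverse_of_surjective
    (LinearMap.range_eq_top.mpr hs)
  have hσ' : ∀ y, f (σ y) = y := fun y => LinearMap.congr_fun hσ y
  let γ : X.carrier →ₗ[ℂ] N.carrier →ₗ[ℂ] ℂ :=
    LinearMap.llcomp ℂ X.carrier (M.carrier →ₗ[ℂ] ℂ) (N.carrier →ₗ[ℂ] ℂ) σ.dualMap β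
  have key : ∀ x m, γ x (f m) = β x m := by
    intro x m
    change β x (σ (f m)) = β x m
    rw [← sub_eq_zero, ← map_sub]
    exact h0 _ _ (by rw [map_sub, hσ', sub_self])
  refine ⟨γ, ⟨fun s w m x => ?_, fun i j hij m hm x hx => ?_⟩, key⟩
  · obtain ⟨x, rfl⟩ := hs x
    rw [← map_smul f, key, key, hβ.1]
  · obtain ⟨y, hy, rfl⟩ := exists_mem_deg_of_surjective hf hs hx
    rw [key]
    exact hβ.2 i (j - e) (by omega) m hm y hy

theorem formPull_injective (X : GMod n W) {M N : GMod n W} {e : ℤ}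
    {f : M.carrier →ₗ[Skew n W] N.carrier} (hf : f ∈ Hom M N e) (hs : Function.Surjective f)
    {d d' : ℤ} (h : d' = d + e) : Function.Injective (formPull X hf h) := by
  intro β γ hβγ
  refine Subtype.ext (LinearMap.ext₂ fun x y => ?_)
  obtain ⟨m, rfl⟩ := hs y
  rw [← formPull_apply X hf h, ← formPull_apply X hf h, hβγ]

/-- Forms on `X × M` of degree `d` agree with forms on `X × N` of degree `d'` when `N` is a quotient
of `M` by a submodule on which all forms vanish. -/
theorem rank_form_eq_of_surjective (X : GMod n W) {M N : GMod n W} {e : ℤ}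
    {f : M.carrier →ₗ[Skew n W] N.carrier} (hf : f ∈ Hom M N e) (hs : Function.Surjective f)
    {d d' : ℤ} (h : d' = d + e) (h0 : ∀ β ∈ form X M d, ∀ x m, f m = 0 → β x m = 0) :
    Module.rank ℂ (form X N d') = Module.rank ℂ (form X M d) := by
  refine LinearEquiv.rank_eq (LinearEquiv.ofBijective (formPull X hf h)
    ⟨formPull_injective X hf hs h, fun β => ?_⟩)
  obtain ⟨γ, hγ, hγβ⟩ := exists_form_descend hf hs h β.2 (h0 _ β.2)
  exact ⟨⟨γ, hγ⟩, Subtype.ext (LinearMap.ext₂ hγβ)⟩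

theorem rank_form_eq_of_bijective (X : GMod n W) {M N : GMod n W} {e : ℤ}
    {f : M.carrier →ₗ[Skew n W] N.carrier} (hf : f ∈ Hom M N e) (hs : Function.Bijective f)
    {d d' : ℤ} (h : d' = d + e) :
    Module.rank ℂ (form X N d') = Module.rank ℂ (form X M d) :=
  rank_form_eq_of_surjective X hf hs.2 h fun β _ x m hm => by
    rw [(map_eq_zero_iff f hs.1).mp hm, map_zero]

/-- An element of `X_i` with `i ≥ b` pairs only with degree `d - i ≤ d - b`. This is what reduces
infinite filtrations to finite ones, one degree at a time. -/
theorem form_apply_eq_zero {X M : GMod n W} {d : ℤ} {b : ℤ} (hX : ∀ i < b, X.deg i = ⊥)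
    {β : X.carrier →ₗ[ℂ] M.carrier →ₗ[ℂ] ℂ} (hβ : β ∈ form X M d) {m : M.carrier}
    (hm : m ∈ M.trunc (d - b)) (x : X.carrier) : β x m = 0 := by
  induction x using X.hom_induction with
  | zero => simp
  | add x y hx hy => rw [map_add, LinearMap.add_apply, hx, hy, add_zero]
  | mem i x hx =>
    by_cases hi : i < b
    · rw [hX i hi] at hx
      rw [(Submodule.mem_bot ℂ).mp hx, map_zero, LinearMap.zero_apply]
    · obtain ⟨s, hs⟩ := M.exists_sum_proj m
      rw [← hs, map_sum]
      refine Finset.sum_eq_zero fun j _ => ?_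
      by_cases hj : j ≤ d - b
      · rw [hm j hj, map_zero]
      · exact hβ.2 i j (by omega) x hx _ (M.proj_mem _ _)

theorem rank_form_eq_zero {X M : GMod n W} {d : ℤ}
    (h : ∀ β ∈ form X M d, ∀ x m, β x m = 0) : Module.rank ℂ (form X M d) = 0 := by
  have : Subsingleton (form X M d) :=
    ⟨fun β γ => Subtype.ext (LinearMap.ext₂ fun x m => by rw [h _ β.2, h _ γ.2])⟩
  exact rank_subsingleton' _ _

/-- An element of the dual module, as a functional. -/
abbrev functional [PreservesGrading n W] {F : GMod n W} [FiniteDimensional ℂ F.carrier]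
    (f : F.dual.carrier) : F.carrier →ₗ[ℂ] ℂ := f

/-- Forms on `X × F` of degree `d` correspond to homomorphisms from `X` to the dual of `F`. -/
def formEquivHom [PreservesGrading n W] (X F : GMod n W) [FiniteDimensional ℂ F.carrier] (d : ℤ) :
    form X F d ≃ₗ[ℂ] Hom X F.dual (-d) where
  toFun β := ⟨
    { toFun := β.1
      map_add' := β.1.map_add
      map_smul' := by
        intro a x
        rw [RingHom.id_apply]
        change β.1 (a • x) = dualAction F a (β.1 x)
        induction a using Skew.induction with
        | zero => rw [zero_smul, map_zero, map_zero, LinearMap.zero_apply]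
        | add a b ha hb => rw [add_smul, map_add, map_add, LinearMap.add_apply, ha, hb]
        | of s w =>
          ext m
          rw [β.2.1, dualAction_of] },
    by
      -- For `x` in `X_i` the functional `β(x, ·)` lives on `F_{d-i}`, so it has degree `i - d` in
      -- the dual; hence the sign in `-d`.
      intro i x hx j hj m hm
      exact β.2.2 i j (by omega) x hx m hm⟩
  invFun f := ⟨f.1.restrictScalars ℂ, fun s w m x => by
      change functional (f.1 ((Skew.of s w : Skew n W) • m)) x = _
      rw [map_smul f.1]
      exact dualAction_of F w s (f.1 m) x,
    fun i j hij m hm x hx => f.2 i m hm j (by omega) x hx⟩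
  map_add' _ _ := rfl
  map_smul' _ _ := rfl
  left_inv _ := rfl
  right_inv _ := rfl

theorem formEquivHom_symm_apply [PreservesGrading n W] (X F : GMod n W)
    [FiniteDimensional ℂ F.carrier] (d : ℤ) (f : Hom X F.dual (-d)) (x : X.carrier)
    (m : F.carrier) :
    ((formEquivHom X F d).symm f).1 x m = functional (f.1 x) m := rfl

end GMod

/-! ### Forms and extension groups -/

namespace GProjRes

variable {Y : GMod n W}

/-- Left exactness of Hom: the kernel of `ε` is the image of `d 0`, so 0-cocycles are exactly the
maps that factor through `ε`, and there are no nonzero 0-coboundaries. -/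
theorem rank_ext_zero [PreservesGrading n W] (R : GProjRes Y) (N : GMod n W) (d : ℤ) :
    Module.rank ℂ (R.Ext N 0 d) = Module.rank ℂ (GMod.Hom Y N d) := by
  have hbot : (R.coboundaries N 0 d).submoduleOf (R.cocycles N 0 d) = ⊥ := by
    rw [eq_bot_iff]
    intro x hx
    exact Subtype.ext hx
  rw [(Submodule.quotEquivOfEqBot _ hbot).rank_eq]
  have hε : ∀ f : Y.carrier →ₗ[Skew n W] N.carrier, f ∈ GMod.Hom Y N d →
      f ∘ₗ R.ε ∈ R.cocycles N 0 d := fun f hf =>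
    ⟨fun i m hm => hf i _ (by simpa using R.ε_mem i m hm), by
      rw [LinearMap.comp_assoc, R.exact_zero.linearMap_comp_eq_zero, LinearMap.comp_zero]⟩
  symm
  refine LinearEquiv.rank_eq (LinearEquiv.ofBijective
    { toFun := fun f => (⟨f.1 ∘ₗ R.ε, hε f.1 f.2⟩ : R.cocycles N 0 d)
      map_add' := fun f g => rfl
      map_smul' := fun c f => rfl } ⟨fun f g hfg => ?_, fun f => ?_⟩)
  · refine Subtype.ext (LinearMap.ext fun y => ?_)
    obtain ⟨x, rfl⟩ := R.surjective y
    exact LinearMap.congr_fun (congrArg Subtype.val hfg) x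
  · obtain ⟨f, hf, hf0⟩ := f
    have hker : LinearMap.ker R.ε ≤ LinearMap.ker f := by
      intro x hx
      obtain ⟨y, rfl⟩ := (R.exact_zero x).mp hx
      exact LinearMap.congr_fun hf0 y
    let g := (LinearMap.ker R.ε).liftQ f hker ∘ₗ
      (R.ε.quotKerEquivOfSurjective R.surjective).symm.toLinearMap
    have hg : ∀ x, g (R.ε x) = f x := by
      intro x
      have : (R.ε.quotKerEquivOfSurjective R.surjective).symm (R.ε x) =
          (LinearMap.ker R.ε).mkQ x := by
        rw [LinearEquiv.symm_apply_eq]; rfl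
      change (LinearMap.ker R.ε).liftQ f hker
        ((R.ε.quotKerEquivOfSurjective R.surjective).symm (R.ε x)) = f x
      rw [this]; rfl
    refine ⟨⟨g, fun i y hy => ?_⟩, Subtype.ext (LinearMap.ext hg)⟩
    obtain ⟨x, hx, rfl⟩ := GMod.exists_mem_deg_of_surjective R.ε_mem R.surjective hy
    rw [hg]
    exact hf i x (by simpa using hx)

/-- Every form on `X₁ × F` that is a cocycle is a coboundary. -/
def FormsLift (R : GProjRes Y) (F : GMod n W) : Prop :=
  ∀ (d : ℤ), ∀ γ ∈ GMod.form (R.X 1) F d, (∀ x m, γ (R.d 1 x) m = 0) →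
    ∃ γ' ∈ GMod.form (R.X 0) F d, ∀ x m, γ' (R.d 0 x) m = γ x m

/-- The vanishing of `Ext¹` in the language of forms, which avoids handling duals of every factor of
a filtration. -/
theorem formsLift_of_ext [PreservesGrading n W] (R : GProjRes Y) (F : GMod n W)
    [FiniteDimensional ℂ F.carrier] (h : ∀ d, Subsingleton (R.Ext F.dual 1 d)) :
    R.FormsLift F := by
  intro d γ hγ h0
  let f := GMod.formEquivHom (R.X 1) F d ⟨γ, hγ⟩
  have hf : f.1 ∈ R.cocycles F.dual 1 (-d) := ⟨f.2, LinearMap.ext fun x => LinearMap.ext (h0 x)⟩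
  have h2 := (Submodule.Quotient.mk_eq_zero ((R.coboundaries F.dual 1 (-d)).submoduleOf
    (R.cocycles F.dual 1 (-d))) (x := ⟨f.1, hf⟩)).mp ((h (-d)).elim _ _)
  obtain ⟨g, hg, hgf⟩ := h2
  refine ⟨_, ((GMod.formEquivHom (R.X 0) F d).symm ⟨g, hg⟩).2, fun x m => ?_⟩
  rw [GMod.formEquivHom_symm_apply]
  exact LinearMap.congr_fun (LinearMap.congr_fun hgf x) m

/-- `FormsLift` speaks of all degrees at once, so it is insensitive to shifts; this is why the
isomorphism may have any degree `e`. -/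
theorem FormsLift.of_bijective {R : GProjRes Y} {F G : GMod n W} {e : ℤ}
    {f : F.carrier →ₗ[Skew n W] G.carrier} (hf : f ∈ GMod.Hom F G e) (hb : Function.Bijective f)
    (h : R.FormsLift G) : R.FormsLift F := by
  intro d γ hγ h0
  obtain ⟨γ₁, hγ₁, e₁⟩ := GMod.exists_form_descend hf hb.2 rfl hγ
    (fun x m hm => by rw [(map_eq_zero_iff f hb.1).mp hm, map_zero])
  obtain ⟨γ₂, hγ₂, e₂⟩ := h _ γ₁ hγ₁ (fun x m => by
    obtain ⟨m, rfl⟩ := hb.2 m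
    rw [e₁, h0])
  exact ⟨GMod.pull _ f γ₂, GMod.pull_mem hf rfl hγ₂, fun x m => by rw [GMod.pull_apply, e₂, e₁]⟩

theorem FormsLift.of_subsingleton (R : GProjRes Y) (F : GMod n W) [Subsingleton F.carrier] :
    R.FormsLift F := by
  intro d γ _ _
  refine ⟨0, Submodule.zero_mem _, fun x m => ?_⟩
  rw [Subsingleton.elim m 0, map_zero, map_zero]

/-- In a short exact sequence `0 → Q' → Q → F → 0`, forms on `Y × Q'` extend to `Y × Q` if the first
extension group of `Y` by the dual of `F` vanishes. -/
theorem FormsLift.exists_extend [PreservesGrading n W] {R : GProjRes Y} {Q' Q F : GMod n W}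
    [FiniteDimensional ℂ Q'.carrier] [FiniteDimensional ℂ Q.carrier]
    (hF : R.FormsLift F) {ι : Q'.carrier →ₗ[Skew n W] Q.carrier} (hι : ι ∈ GMod.Hom Q' Q 0)
    (hinj : Function.Injective ι) {π : Q.carrier →ₗ[Skew n W] F.carrier}
    (hπ : π ∈ GMod.Hom Q F 0) (hsurj : Function.Surjective π) (hex : Function.Exact ι π)
    {d : ℤ} {β : Y.carrier →ₗ[ℂ] Q'.carrier →ₗ[ℂ] ℂ} (hβ : β ∈ GMod.form Y Q' d) :
    ∃ β' ∈ GMod.form Y Q d, ∀ y m, β' y (ι m) = β y m := by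
  let f : Module.Dual ℂ Q.carrier →ₗ[ℂ] Module.Dual ℂ Q'.carrier := (ι.restrictScalars ℂ).dualMap
  have hf : ∀ φ m, f φ m = φ (ι m) := fun _ _ => rfl
  have hfa : ∀ a φ, f (dualAction Q a φ) = dualAction Q' a (f φ) := by
    intro a φ
    induction a using Skew.induction with
    | zero => simp only [map_zero, LinearMap.zero_apply]
    | add a b ha hb => simp only [map_add, LinearMap.add_apply, ha, hb]
    | of s w =>
      refine LinearMap.ext fun m => ?_
      rw [hf, dualAction_of, dualAction_of, hf, map_smul ι]
  -- Projectivity concerns maps of degree 0, whereas `β` corresponds to a map of degree `-d`;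
  -- shifting the duals by `d` repairs this.
  let fA : (Q.dual.shift d).carrier →ₗ[Skew n W] (Q'.dual.shift d).carrier :=
    { toFun := f
      map_add' := map_add f
      map_smul' := hfa }
  have hfA : fA ∈ GMod.Hom (Q.dual.shift d) (Q'.dual.shift d) 0 := by
    intro i φ hφ j hj m hm
    exact hφ j (by omega) _ (by simpa using hι j m hm)
  have hfs : Function.Surjective fA :=
    LinearMap.dualMap_surjective_of_injective (f := ι.restrictScalars ℂ) hinj
  have fin1 : Module.Finite (Skew n W) (Q.dual.shift d).carrier := by
    have : Module.Finite ℂ (Q.dual.shift d).carrier :=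
      inferInstanceAs (Module.Finite ℂ (Module.Dual ℂ Q.carrier))
    exact Module.Finite.of_restrictScalars_finite ℂ _ _
  have fin2 : Module.Finite (Skew n W) (Q'.dual.shift d).carrier := by
    have : Module.Finite ℂ (Q'.dual.shift d).carrier :=
      inferInstanceAs (Module.Finite ℂ (Module.Dual ℂ Q'.carrier))
    exact Module.Finite.of_restrictScalars_finite ℂ _ _
  let b := GMod.formEquivHom Y Q' d ⟨β, hβ⟩
  let g : (R.X 0).carrier →ₗ[Skew n W] (Q'.dual.shift d).carrier := b.1 ∘ₗ R.ε
  have hg : g ∈ GMod.Hom (R.X 0) (Q'.dual.shift d) 0 := by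
    intro i x hx
    have h1 : R.ε x ∈ Y.deg i := by simpa using R.ε_mem i x hx
    have h2 := b.2 i _ h1
    change b.1 (R.ε x) ∈ Q'.dual.deg (i + 0 - d)
    convert h2 using 2
    ring
  obtain ⟨h, hh, hfh⟩ := (R.projective 0).2 _ _ fin1 fin2 fA hfA hfs g hg
  have hh' : (h : (R.X 0).carrier →ₗ[Skew n W] Q.dual.carrier) ∈
      GMod.Hom (R.X 0) Q.dual (-d) := by
    intro i x hx
    have h2 := hh i x hx
    change h x ∈ Q.dual.deg (i + 0 - d) at h2
    rwa [add_zero, sub_eq_add_neg] at h2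
  let γ := (GMod.formEquivHom (R.X 0) Q d).symm ⟨h, hh'⟩
  have hγ : ∀ x m, γ.1 x (ι m) = β (R.ε x) m := fun x m =>
    LinearMap.congr_fun (LinearMap.congr_fun hfh x) m
  have hex0 : ∀ x, R.ε (R.d 0 x) = 0 := fun x => R.exact_zero.apply_apply_eq_zero x
  -- The lift `γ` on `X₀ × Q` need not come from `Y × Q`; the obstruction is its pullback along `d
  -- 0`. On `Q'` it equals `β` after `ε ∘ d 0 = 0`, so it descends to a cocycle on `X₁ × F`.
  let γd : (R.X 1).carrier →ₗ[ℂ] Q.carrier →ₗ[ℂ] ℂ := γ.1 ∘ₗ (R.d 0).restrictScalars ℂ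
  have hγd : γd ∈ GMod.form (R.X 1) Q d := by
    refine ⟨fun s w m x => ?_, fun i j hij m hm x hx => ?_⟩
    · change γ.1 (R.d 0 ((Skew.of s w : Skew n W) • m)) x = _
      rw [map_smul, γ.2.1]; rfl
    · exact γ.2.2 i j hij _ (by simpa using R.d_mem 0 i m hm) x hx
  obtain ⟨γ₁, hγ₁, e₁⟩ := GMod.exists_form_descend (d' := d) hπ hsurj (by ring) hγd (by
    intro x q hq
    obtain ⟨m, rfl⟩ := (hex q).mp hq
    change γ.1 (R.d 0 x) (ι m) = 0
    rw [hγ, hex0, map_zero, LinearMap.zero_apply])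
  obtain ⟨γ₂, hγ₂, e₂⟩ := hF d γ₁ hγ₁ (fun x m => by
    obtain ⟨m, rfl⟩ := hsurj m
    rw [e₁]
    change γ.1 (R.d 0 (R.d 1 x)) m = 0
    rw [(R.exact_succ 0).apply_apply_eq_zero, map_zero, LinearMap.zero_apply])
  -- The correction removes the obstruction and leaves the restriction to `Q'` unchanged, because `π
  -- ∘ ι = 0`.
  have hδ : γ.1 - GMod.pull _ π γ₂ ∈ GMod.form (R.X 0) Q d :=
    Submodule.sub_mem _ γ.2 (GMod.pull_mem hπ (by ring) hγ₂)
  obtain ⟨δ, hδ', e₃⟩ := GMod.exists_form_descend (d' := d) R.ε_mem R.surjective (by ring)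
    (GMod.flip_mem_form hδ) (by
    intro q x hx
    obtain ⟨x, rfl⟩ := (R.exact_zero x).mp hx
    rw [LinearMap.flip_apply, LinearMap.sub_apply, LinearMap.sub_apply, GMod.pull_apply, e₂, e₁]
    exact sub_self _)
  refine ⟨δ.flip, GMod.flip_mem_form hδ', fun y m => ?_⟩
  obtain ⟨x, rfl⟩ := R.surjective y
  rw [LinearMap.flip_apply, e₃, LinearMap.flip_apply, LinearMap.sub_apply, LinearMap.sub_apply,
    GMod.pull_apply, hγ, hex.apply_apply_eq_zero, map_zero, sub_zero]

/-- Forms turn the sequence into `0 → form Y F → form Y Q → form Y Q' → 0`; surjectivity on the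
right is `exists_extend`. Cardinal ranks make the sum valid before any space of forms is known to be
finite-dimensional. -/
theorem FormsLift.rank_form [PreservesGrading n W] {R : GProjRes Y} {Q' Q F : GMod n W}
    [FiniteDimensional ℂ Q'.carrier] [FiniteDimensional ℂ Q.carrier]
    (hF : R.FormsLift F) {ι : Q'.carrier →ₗ[Skew n W] Q.carrier} (hι : ι ∈ GMod.Hom Q' Q 0)
    (hinj : Function.Injective ι) {π : Q.carrier →ₗ[Skew n W] F.carrier}
    (hπ : π ∈ GMod.Hom Q F 0) (hsurj : Function.Surjective π) (hex : Function.Exact ι π)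
    (d : ℤ) : Module.rank ℂ (GMod.form Y Q d) =
      Module.rank ℂ (GMod.form Y F d) + Module.rank ℂ (GMod.form Y Q' d) := by
  let r := GMod.formPull Y hι (d := d) (d' := d) (by ring)
  let p := GMod.formPull Y hπ (d := d) (d' := d) (by ring)
  have hr : LinearMap.range r = ⊤ := by
    rw [LinearMap.range_eq_top]
    intro β
    obtain ⟨β', hβ', e⟩ := hF.exists_extend hι hinj hπ hsurj hex β.2
    exact ⟨⟨β', hβ'⟩, Subtype.ext (LinearMap.ext₂ e)⟩
  have hp : LinearMap.range p = LinearMap.ker r := by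
    apply le_antisymm
    · rintro _ ⟨β, rfl⟩
      refine Subtype.ext (LinearMap.ext₂ fun y m => ?_)
      rw [GMod.formPull_apply, GMod.formPull_apply, hex.apply_apply_eq_zero, map_zero]; rfl
    · intro β hβ
      obtain ⟨γ, hγ, e⟩ := GMod.exists_form_descend (d' := d) hπ hsurj (by ring) β.2 (by
        intro y q hq
        obtain ⟨m, rfl⟩ := (hex q).mp hq
        exact LinearMap.congr_fun₂ (congrArg Subtype.val hβ) y m)
      exact ⟨⟨γ, hγ⟩, Subtype.ext (LinearMap.ext₂ e)⟩
  have h1 := LinearMap.rank_range_add_rank_ker (R := ℂ) (M := GMod.form Y Q d)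
    (M₁ := GMod.form Y Q' d) r
  have h2 : Module.rank ℂ (GMod.form Y F d) = Module.rank ℂ (LinearMap.range p) :=
    (LinearEquiv.ofInjective p (GMod.formPull_injective Y hπ hsurj _)).rank_eq
  rw [hr, rank_top, ← hp, ← h2] at h1
  rw [← h1, add_comm]

end GProjRes

/-! ### Multiplicities in filtrations -/

theorem GMod.exists_subquot_exact (M : GMod n W) {A B C : Submodule (Skew n W) M.carrier}
    (hA : M.IsGradedSub A) (hB : M.IsGradedSub B) (hC : M.IsGradedSub C) (hBA : B ≤ A)
    (hCB : C ≤ B) :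
    ∃ ι ∈ Hom (M.subquot hB hC) (M.subquot hA hC) 0, ∃ π ∈ Hom (M.subquot hA hC) (M.subquot hA hB) 0,
      Function.Injective ι ∧ Function.Surjective π ∧ Function.Exact ι π := by
  let f : B →ₗ[Skew n W] (M.subquot hA hC).carrier :=
    M.toSubquot hA hC ∘ₗ Submodule.inclusion hBA
  have hf : f ∈ Hom (M.sub B hB) (M.subquot hA hC) 0 := fun i x hx =>
    toSubquot_mem hA hC i (Submodule.inclusion hBA x) hx
  have hf0 : ∀ x : B, f x = 0 ↔ (x : M.carrier) ∈ C := fun x =>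
    toSubquot_eq_zero hA hC (x := Submodule.inclusion hBA x)
  obtain ⟨ι, hι, eι⟩ := exists_subquot_lift hB hC f hf fun x hx => (hf0 x).mpr hx
  obtain ⟨π, hπ, eπ⟩ := exists_subquot_lift hA hC (M.toSubquot hA hB) (toSubquot_mem hA hB)
    fun x hx => (toSubquot_eq_zero hA hB).mpr (hCB hx)
  refine ⟨ι, hι, π, hπ, ?_, fun y => ?_, fun y => ?_⟩
  · rw [injective_iff_map_eq_zero]
    intro y hy
    obtain ⟨x, rfl⟩ := toSubquot_surjective hB hC y
    rw [eι, hf0] at hy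
    exact (toSubquot_eq_zero hB hC).mpr hy
  · obtain ⟨x, rfl⟩ := toSubquot_surjective hA hB y
    exact ⟨M.toSubquot hA hC x, eπ x⟩
  · obtain ⟨x, rfl⟩ := toSubquot_surjective hA hC y
    rw [eπ, toSubquot_eq_zero]
    constructor
    · intro hx
      exact ⟨M.toSubquot hB hC ⟨x, hx⟩, eι _⟩
    · rintro ⟨z, hz⟩
      obtain ⟨z, rfl⟩ := toSubquot_surjective hB hC z
      rw [eι] at hz
      have h : (x : M.carrier) - z ∈ C := by
        refine (toSubquot_eq_zero hA hC (x := x - Submodule.inclusion hBA z)).mp ?_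
        rw [map_sub, ← hz]
        exact sub_self _
      have := B.add_mem (hCB h) z.2
      rwa [sub_add_cancel] at this

namespace SepFiltration

variable {M : GMod n W}

theorem antitone (Φ : SepFiltration M) : Antitone Φ.N := antitone_nat_of_succ_le Φ.anti

/-- In a fixed degree a separable decreasing filtration of a finite-dimensional space reaches zero,
and only finitely many degrees lie between the lower bound of `M` and `D`. -/
theorem exists_le_trunc (Φ : SepFiltration M) [hb : M.BoundedBelow]
    (hM : ∀ i, FiniteDimensional ℂ (M.deg i)) (D : ℤ) : ∃ k, Φ.N k ≤ M.trunc D := by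
  have key : ∀ i, ∃ k, ∀ x ∈ Φ.N k, x ∈ M.deg i → x = 0 := by
    intro i
    let V : ℕ →o (Submodule ℂ (M.deg i))ᵒᵈ :=
      { toFun := fun k => OrderDual.toDual
          (((Φ.N k).restrictScalars ℂ).comap (M.deg i).subtype)
        monotone' := fun j k hjk x hx => Φ.antitone hjk hx }
    have := hM i
    obtain ⟨k, hk⟩ := IsArtinian.monotone_stabilizes V
    refine ⟨k, fun x hx hxi => ?_⟩
    have hall : x ∈ ⨅ j, Φ.N j := by
      rw [Submodule.mem_iInf]
      intro j
      rcases le_total k j with h | h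
      · have h1 : (⟨x, hxi⟩ : M.deg i) ∈ OrderDual.ofDual (V k) := hx
        rw [hk j h] at h1
        exact h1
      · exact Φ.antitone h hx
    rw [Φ.separable] at hall
    exact hall
  choose k hk using key
  obtain ⟨b, hb⟩ := hb.exists_bound
  refine ⟨(Finset.Icc b D).sup k, fun x hx i hi => ?_⟩
  by_cases h : i < b
  · have := M.proj_mem i x
    rw [hb i h] at this
    exact this
  · exact hk i _ (Φ.antitone (Finset.le_sup (Finset.mem_Icc.mpr ⟨not_lt.mp h, hi⟩))
      (Φ.graded _ i x hx)) (M.proj_mem i x)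

end SepFiltration

namespace GMod

theorem Iso.bijective_hom {M N : GMod n W} {d : ℤ} (h : M.Iso (N.shift d)) :
    ∃ f ∈ Hom M N (-d), Function.Bijective f := by
  obtain ⟨e, he⟩ := h
  exact ⟨(e.toLinearMap : M.carrier →ₗ[Skew n W] N.carrier), fun i m hm => (he i m).mp hm,
    e.bijective⟩

theorem Iso.of_bijective_hom {M N : GMod n W} {d : ℤ} {f : M.carrier →ₗ[Skew n W] N.carrier}
    (hf : f ∈ Hom M N (-d)) (hb : Function.Bijective f) : M.Iso (N.shift d) := by
  refine iso_of_bijective (N := N.shift d) (f := f) (fun i m hm => ?_) hb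
  change f m ∈ N.deg (i + 0 - d)
  rw [add_zero, sub_eq_add_neg]
  exact hf i m hm

end GMod

section Count

variable {Λ : Type*} {F : Λ → GMod n W} {Y : GMod n W}

open Classical in
/-- The forms on `Y × F_α⟨e⟩` when `Y` is orthogonal to the family `F` except for one member. -/
theorem rank_form_factor {α₀ : Λ} (h1 : Module.rank ℂ (GMod.form Y (F α₀) 0) = 1)
    (h0 : ∀ α d, ¬(α = α₀ ∧ d = 0) → Module.rank ℂ (GMod.form Y (F α) d) = 0) {G : GMod n W}
    (hG : Subsingleton G.carrier ∨ ∃ α d, G.Iso ((F α).shift d)) (d : ℤ) :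
    Module.rank ℂ (GMod.form Y G d) = if G.Iso ((F α₀).shift d) then 1 else 0 := by
  have hiso : ∀ α e, G.Iso ((F α).shift e) → Module.rank ℂ (GMod.form Y G d) =
      Module.rank ℂ (GMod.form Y (F α) (d - e)) := by
    intro α e h
    obtain ⟨f, hf, hb⟩ := h.bijective_hom
    rw [← GMod.rank_form_eq_of_bijective Y hf hb (d' := d - e) (by ring)]
  split_ifs with h
  · rw [hiso α₀ d h, sub_self, h1]
  · rcases hG with hG | ⟨α, e, he⟩
    · exact GMod.rank_form_eq_zero fun β _ x m => by rw [Subsingleton.elim m 0, map_zero]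
    · rw [hiso α e he, h0]
      rintro ⟨rfl, hde⟩
      exact h ((sub_eq_zero.mp hde) ▸ he)

theorem finiteDimensional_factor [∀ α, FiniteDimensional ℂ (F α).carrier] {G : GMod n W}
    (hG : Subsingleton G.carrier ∨ ∃ α d, G.Iso ((F α).shift d)) :
    FiniteDimensional ℂ G.carrier := by
  rcases hG with hG | ⟨α, e, he⟩
  · infer_instance
  · obtain ⟨f, _, hb⟩ := he.bijective_hom
    exact Module.Finite.of_injective (f.restrictScalars ℂ) hb.1

theorem formsLift_factor {R : GProjRes Y} (hR : ∀ α, R.FormsLift (F α)) {G : GMod n W}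
    (hG : Subsingleton G.carrier ∨ ∃ α d, G.Iso ((F α).shift d)) : R.FormsLift G := by
  rcases hG with hG | ⟨α, e, he⟩
  · exact .of_subsingleton R G
  · obtain ⟨f, hf, hb⟩ := he.bijective_hom
    exact .of_bijective hf hb (hR α)

-- The top factor is peeled off at each stage, since additivity asks for `FormsLift` only of the
-- quotient in the exact sequence and here that quotient is a single factor.
open Classical in
theorem SepFiltration.rank_form_subquot [PreservesGrading n W]
    [∀ α, FiniteDimensional ℂ (F α).carrier] {R : GProjRes Y} (hR : ∀ α, R.FormsLift (F α))
    {α₀ : Λ} (h1 : Module.rank ℂ (GMod.form Y (F α₀) 0) = 1)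
    (h0 : ∀ α d, ¬(α = α₀ ∧ d = 0) → Module.rank ℂ (GMod.form Y (F α) d) = 0) {M : GMod n W}
    (Φ : SepFiltration M) (hΦ : Φ.IsFilteredBy F) (d : ℤ) (i j : ℕ) :
    FiniteDimensional ℂ (M.subquot (Φ.graded i) (Φ.graded (i + j))).carrier ∧
      Module.rank ℂ (GMod.form Y (M.subquot (Φ.graded i) (Φ.graded (i + j))) d) =
        (((Finset.Ico i (i + j)).filter
          fun l => (Φ.factor l).Iso ((F α₀).shift d)).card : Cardinal) := by
  induction j generalizing i with
  | zero =>
    have hs : Subsingleton (M.subquot (Φ.graded i) (Φ.graded (i + 0))).carrier :=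
      (GMod.subsingleton_subquot_iff _ _).mpr le_rfl
    refine ⟨inferInstance, ?_⟩
    rw [GMod.rank_form_eq_zero fun β _ x m => by rw [Subsingleton.elim m 0, map_zero]]
    simp
  | succ j ih =>
    obtain ⟨fin, hr⟩ := ih (i + 1)
    have hij : i + (j + 1) = i + 1 + j := by omega
    rw [hij]
    obtain ⟨ι, hι, π, hπ, hinj, hsurj, hex⟩ := M.exists_subquot_exact (Φ.graded i)
      (Φ.graded (i + 1)) (Φ.graded (i + 1 + j)) (Φ.anti i) (Φ.antitone (by omega))
    have fin' : FiniteDimensional ℂ (M.subquot (Φ.graded i) (Φ.graded (i + 1))).carrier :=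
      finiteDimensional_factor (hΦ i)
    have fin'' : FiniteDimensional ℂ (M.subquot (Φ.graded i) (Φ.graded (i + 1 + j))).carrier :=
      Module.Finite.of_exact (f := ι.restrictScalars ℂ) (g := π.restrictScalars ℂ) hex hsurj
    refine ⟨fin'', ?_⟩
    rw [(formsLift_factor hR (hΦ i)).rank_form hι hinj hπ hsurj hex d, hr,
      rank_form_factor h1 h0 (hΦ i) d,
      ← Finset.insert_Ico_add_one_left_eq_Ico (show i < i + 1 + j by omega), Finset.filter_insert]
    split_ifs with h
    · rw [Finset.card_insert_of_notMem (by simp), Nat.cast_add, Nat.cast_one, add_comm]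
    · rw [zero_add]

/-- In a filtration by members of a family that is orthogonal to `Y` except for one member, the
multiplicities of this member are the dimensions of the spaces of forms. -/
theorem SepFiltration.ncard_eq_rank_form [PreservesGrading n W]
    [∀ α, FiniteDimensional ℂ (F α).carrier] {R : GProjRes Y} (hR : ∀ α, R.FormsLift (F α))
    {α₀ : Λ} (h1 : Module.rank ℂ (GMod.form Y (F α₀) 0) = 1)
    (h0 : ∀ α d, ¬(α = α₀ ∧ d = 0) → Module.rank ℂ (GMod.form Y (F α) d) = 0)
    [hY : Y.BoundedBelow] {M : GMod n W} [M.BoundedBelow]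
    (hM : ∀ i, FiniteDimensional ℂ (M.deg i)) (Φ : SepFiltration M) (hΦ : Φ.IsFilteredBy F)
    (d : ℤ) : {i | (Φ.factor i).Iso ((F α₀).shift d)}.Finite ∧
      ({i | (Φ.factor i).Iso ((F α₀).shift d)}.ncard : Cardinal) =
        Module.rank ℂ (GMod.form Y M d) := by
  classical
  obtain ⟨b, hb⟩ := hY.exists_bound
  -- With `Y` in degrees at least `b`, forms of degree `d` cannot see anything above degree `d - b`.
  obtain ⟨k, hk⟩ := Φ.exists_le_trunc hM (d - b)
  have hlt : ∀ i, (Φ.factor i).Iso ((F α₀).shift d) → i < k := by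
    intro i hi
    by_contra hik
    -- A factor beyond stage `k` lives above degree `d - b` and carries no forms, whereas
    -- `F_{α₀}⟨d⟩` carries a one-dimensional space of them.
    have hz : Module.rank ℂ (GMod.form Y (Φ.factor i) d) = 0 := by
      refine GMod.rank_form_eq_zero fun β hβ y q => GMod.form_apply_eq_zero hb hβ ?_ y
      intro j hj
      have hbot : (Φ.factor i).deg j = ⊥ :=
        GMod.deg_subquot_eq_bot (Φ.graded i) (Φ.graded (i + 1)) fun x hx hxj => by
          have := hk (Φ.antitone (not_lt.mp hik) hx) j hj
          rw [GMod.proj_of_mem hxj] at this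
          rw [this]
          exact Submodule.zero_mem _
      have hm := (Φ.factor i).proj_mem j q
      rw [hbot] at hm
      exact hm
    rw [rank_form_factor h1 h0 (hΦ i), if_pos hi] at hz
    exact one_ne_zero hz
  have hset : {i | (Φ.factor i).Iso ((F α₀).shift d)} = ↑((Finset.Ico 0 (0 + k)).filter
      fun l => (Φ.factor l).Iso ((F α₀).shift d)) := by
    ext i
    simpa using hlt i
  rw [hset]
  refine ⟨Finset.finite_toSet _, ?_⟩
  rw [Set.ncard_coe_finset, ← (Φ.rank_form_subquot hR h1 h0 hΦ d 0 k).2]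
  let p : M.carrier →ₗ[Skew n W] (M.subquot (Φ.graded 0) (Φ.graded (0 + k))).carrier :=
    M.toSubquot (Φ.graded 0) (Φ.graded (0 + k)) ∘ₗ
      LinearMap.codRestrict (Φ.N 0) LinearMap.id (fun x => by rw [Φ.zero]; trivial)
  have hp : p ∈ GMod.Hom M _ 0 := fun i x hx => GMod.toSubquot_mem _ _ i _ hx
  have hp0 : ∀ x, p x = 0 ↔ x ∈ Φ.N (0 + k) := fun x =>
    GMod.toSubquot_eq_zero (Φ.graded 0) (Φ.graded (0 + k))
  have hps : Function.Surjective p := by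
    intro y
    obtain ⟨x, rfl⟩ := GMod.toSubquot_surjective _ _ y
    exact ⟨x, rfl⟩
  refine GMod.rank_form_eq_of_surjective Y hp hps (by ring) fun β hβ y m hm => ?_
  rw [hp0, zero_add] at hm
  exact GMod.form_apply_eq_zero hb hβ (hk hm) y

end Count

/-! ### Refining filtrations -/

/-- An infinite concatenation of finite chains of a reflexive relation. -/
theorem exists_seq_of_reflTransGen {α : Type*} {r : α → α → Prop} (hr : ∀ a, r a a) (x : ℕ → α)
    (h : ∀ t, Relation.ReflTransGen r (x t) (x (t + 1))) :
    ∃ y : ℕ → α, y 0 = x 0 ∧ (∀ i, r (y i) (y (i + 1))) ∧ ∀ t, ∃ i, y i = x t := by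
  let C : ℕ → α → α → Prop := fun k => Nat.rec (fun a b => a = b)
    (fun _ C a b => ∃ c, r a c ∧ C c b) k
  have hC : ∀ {a b}, Relation.ReflTransGen r a b → ∃ k, C k a b := by
    intro a b hab
    induction hab using Relation.ReflTransGen.head_induction_on with
    | refl => exact ⟨0, rfl⟩
    | head hac _ ih =>
      obtain ⟨k, hk⟩ := ih
      exact ⟨k + 1, _, hac, hk⟩
  -- A state `(t, k, a)` records that `a` is `k` links away from `x (t + 1)`.
  let S := {s : ℕ × ℕ × α // C s.2.1 s.2.2 (x (s.1 + 1))}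
  have next : ∀ s : S, ∃ s' : S, r s.1.2.2 s'.1.2.2 ∧
      (s.1.2.1 = 0 → s'.1.1 = s.1.1 + 1 ∧ s'.1.2.2 = x (s.1.1 + 1)) ∧
      ∀ k, s.1.2.1 = k + 1 → s'.1.1 = s.1.1 ∧ s'.1.2.1 = k := by
    rintro ⟨⟨t, k, a⟩, ha⟩
    cases k with
    | zero =>
      -- When a chain is exhausted, one trivial link starts the next chain. Thus empty chains also
      -- consume an index and the process never stalls; this is the use of reflexivity.
      obtain ⟨k', hk'⟩ := hC (h (t + 1))
      have ha' : a = x (t + 1) := ha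
      refine ⟨⟨(t + 1, k', x (t + 1)), hk'⟩, ?_, fun _ => ⟨rfl, rfl⟩, fun k hk => ?_⟩
      · subst ha'
        exact hr _
      · exact absurd hk (Nat.succ_ne_zero k).symm
    | succ k =>
      obtain ⟨c, hac, hc⟩ := ha
      refine ⟨⟨(t, k, c), hc⟩, hac, fun h0 => absurd h0 (Nat.succ_ne_zero k), fun k' hk' => ?_⟩
      exact ⟨rfl, Nat.succ_injective hk'⟩
  choose f hf using next
  obtain ⟨k₀, hk₀⟩ := hC (h 0)
  let s : ℕ → S := fun i => f^[i] ⟨(0, k₀, x 0), hk₀⟩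
  have hs : ∀ i, s (i + 1) = f (s i) := fun i => Function.iterate_succ_apply' f i _
  have reach : ∀ k i, (s i).1.2.1 = k →
      ∃ j, (s j).1.1 = (s i).1.1 + 1 ∧ (s j).1.2.2 = x ((s i).1.1 + 1) := by
    intro k
    induction k with
    | zero =>
      intro i hi
      exact ⟨i + 1, hs i ▸ (hf (s i)).2.1 hi⟩
    | succ k ih =>
      intro i hi
      obtain ⟨h1, h2⟩ := (hf (s i)).2.2 k hi
      rw [← hs] at h1 h2
      obtain ⟨j, hj⟩ := ih (i + 1) h2
      rw [h1] at hj
      exact ⟨j, hj⟩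
  refine ⟨fun i => (s i).1.2.2, rfl, fun i => ?_, fun t => ?_⟩
  · change r (s i).1.2.2 (s (i + 1)).1.2.2
    rw [hs]
    exact (hf (s i)).1
  · suffices ∃ i, (s i).1.1 = t ∧ (s i).1.2.2 = x t from this.imp fun _ hi => hi.2
    induction t with
    | zero => exact ⟨0, rfl, rfl⟩
    | succ t ih =>
      obtain ⟨i, hi, _⟩ := ih
      obtain ⟨j, hj⟩ := reach _ i rfl
      rw [hi] at hj
      exact ⟨j, hj⟩

namespace GMod

theorem hom_comp {L M N : GMod n W} {d e c : ℤ} {g : M.carrier →ₗ[Skew n W] N.carrier}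
    {f : L.carrier →ₗ[Skew n W] M.carrier} (hg : g ∈ Hom M N e) (hf : f ∈ Hom L M d)
    (hc : c = d + e) : g ∘ₗ f ∈ Hom L N c := fun i m hm => by
  rw [hc, ← add_assoc]
  exact hg _ _ (hf i m hm)

theorem Iso.symm {M N : GMod n W} (h : M.Iso N) : N.Iso M := by
  obtain ⟨e, he⟩ := h
  exact ⟨e.symm, fun i m => by rw [he, LinearEquiv.apply_symm_apply]⟩

theorem Iso.trans {L M N : GMod n W} (h : L.Iso M) (h' : M.Iso N) : L.Iso N := by
  obtain ⟨e, he⟩ := h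
  obtain ⟨e', he'⟩ := h'
  exact ⟨e.trans e', fun i m => by rw [he, he']; rfl⟩

/-! ### Single filtration steps and their transport between subquotients. -/

variable {M : GMod n W} {Λ : Type*} (F : Λ → GMod n W)

/-- A graded module is zero or a shift of a member of the family `F`. -/
def IsShiftOf (G : GMod n W) : Prop :=
  Subsingleton G.carrier ∨ ∃ α d, G.Iso ((F α).shift d)

variable {F} in
theorem IsShiftOf.of_iso {G H : GMod n W} (h : G.Iso H) (hG : G.IsShiftOf F) : H.IsShiftOf F := by
  rcases hG with hG | ⟨α, d, hd⟩
  · obtain ⟨e, _⟩ := h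
    exact Or.inl e.symm.toEquiv.subsingleton
  · exact Or.inr ⟨α, d, h.symm.trans hd⟩

/-- `A / B` is zero or a shift of a member of the family `F`. -/
def Step (A B : Submodule (Skew n W) M.carrier) : Prop :=
  ∃ (hA : M.IsGradedSub A) (hB : M.IsGradedSub B), B ≤ A ∧ (M.subquot hA hB).IsShiftOf F

/-- The second isomorphism theorem for graded submodules. -/
theorem subquot_iso {A B A' B' : Submodule (Skew n W) M.carrier} (hA : M.IsGradedSub A)
    (hB : M.IsGradedSub B) (hA' : M.IsGradedSub A') (hB' : M.IsGradedSub B') (h1 : A ≤ A')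
    (h2 : B ≤ B') (h3 : A' ≤ A ⊔ B') (h4 : A ⊓ B' ≤ B) :
    (M.subquot hA hB).Iso (M.subquot hA' hB') := by
  let f : A →ₗ[Skew n W] (M.subquot hA' hB').carrier :=
    M.toSubquot hA' hB' ∘ₗ Submodule.inclusion h1
  have hf0 : ∀ x : A, f x = 0 ↔ (x : M.carrier) ∈ B' := fun x =>
    toSubquot_eq_zero hA' hB' (x := Submodule.inclusion h1 x)
  obtain ⟨g, hg, e⟩ := exists_subquot_lift hA hB f (N := M.subquot hA' hB') (d := 0)
    (fun i x hx => toSubquot_mem hA' hB' i (Submodule.inclusion h1 x) hx)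
    fun x hx => (hf0 x).mpr (h2 hx)
  refine iso_of_bijective hg ⟨?_, fun y => ?_⟩
  · rw [injective_iff_map_eq_zero]
    intro y hy
    obtain ⟨x, rfl⟩ := toSubquot_surjective hA hB y
    rw [e, hf0] at hy
    exact (toSubquot_eq_zero hA hB).mpr (h4 ⟨x.2, hy⟩)
  · obtain ⟨⟨y, hy⟩, rfl⟩ := toSubquot_surjective hA' hB' y
    obtain ⟨a, ha, b, hb, rfl⟩ := Submodule.mem_sup.mp (h3 hy)
    refine ⟨M.toSubquot hA hB ⟨a, ha⟩, ?_⟩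
    rw [e, ← sub_eq_zero]
    change M.toSubquot hA' hB' (Submodule.inclusion h1 ⟨a, ha⟩) - M.toSubquot hA' hB' ⟨a + b, hy⟩ = 0
    rw [← map_sub, toSubquot_eq_zero]
    change a - (a + b) ∈ B'
    rw [sub_add_cancel_left]
    exact B'.neg_mem hb

variable {F} {A B A' B' L : Submodule (Skew n W) M.carrier}

theorem Step.left (h : Step F A B) : M.IsGradedSub A := h.1
theorem Step.right (h : Step F A B) : M.IsGradedSub B := h.2.1
theorem Step.le (h : Step F A B) : B ≤ A := h.2.2.1

theorem Step.refl (hA : M.IsGradedSub A) : Step F A A :=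
  ⟨hA, hA, le_rfl, Or.inl ((subsingleton_subquot_iff hA hA).mpr le_rfl)⟩

/-- The inclusions say `A' = A + B'` and `B = A ∩ B'`, so `A/B` and `A'/B'` are isomorphic.
`Step.up` and `Step.down` are the two directions of transport. -/
theorem Step.up (h : Step F A B) (hA' : M.IsGradedSub A') (hB' : M.IsGradedSub B')
    (h0 : B' ≤ A') (h1 : A ≤ A') (h2 : B ≤ B') (h3 : A' ≤ A ⊔ B') (h4 : A ⊓ B' ≤ B) :
    Step F A' B' :=
  ⟨hA', hB', h0, h.2.2.2.of_iso (subquot_iso h.left h.right hA' hB' h1 h2 h3 h4)⟩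

theorem Step.down (h : Step F A' B') (hA : M.IsGradedSub A) (hB : M.IsGradedSub B)
    (h0 : B ≤ A) (h1 : A ≤ A') (h2 : B ≤ B') (h3 : A' ≤ A ⊔ B') (h4 : A ⊓ B' ≤ B) :
    Step F A B :=
  ⟨hA, hB, h0, h.2.2.2.of_iso (subquot_iso hA hB h.left h.right h1 h2 h3 h4).symm⟩

/-- The factor is finite-dimensional and therefore zero in high degrees. This is what allows steps
to be interchanged with high-degree tails. -/
theorem Step.exists_trunc [∀ α, FiniteDimensional ℂ (F α).carrier] (h : Step F A B) :
    ∃ D, A ⊓ M.trunc D ≤ B := by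
  obtain ⟨hA, hB, _, hs | ⟨α, d, hd⟩⟩ := h
  · exact ⟨0, inf_le_left.trans ((subsingleton_subquot_iff hA hB).mp hs)⟩
  · obtain ⟨f, hf, hb⟩ := hd.bijective_hom
    obtain ⟨b, hbot⟩ := (F α).exists_deg_eq_bot
    refine ⟨b + d, fun x hx => ?_⟩
    obtain ⟨s, hs⟩ := M.exists_sum_proj x
    rw [← hs]
    refine B.sum_mem fun i _ => ?_
    by_cases hi : i ≤ b + d
    · rw [hx.2 i hi]
      exact B.zero_mem
    · have hxi : M.proj i x ∈ A := hA i x hx.1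
      have h1 := hf i _ (by simpa using toSubquot_mem hA hB i ⟨_, hxi⟩ (M.proj_mem i x))
      rw [hbot _ (by omega)] at h1
      exact (toSubquot_eq_zero hA hB (x := ⟨_, hxi⟩)).mp ((map_eq_zero_iff f hb.1).mp h1)

theorem le_of_reflTransGen_step (h : Relation.ReflTransGen (Step F) A B) : B ≤ A := by
  induction h with
  | refl => exact le_rfl
  | tail _ h ih => exact h.le.trans ih

theorem isGradedSub_of_reflTransGen_step (hA : M.IsGradedSub A)
    (h : Relation.ReflTransGen (Step F) A B) : M.IsGradedSub B := by
  rcases h.cases_tail with rfl | ⟨C, _, h⟩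
  · exact hA
  · exact h.right

theorem exists_trunc_of_reflTransGen_step [∀ α, FiniteDimensional ℂ (F α).carrier]
    (h : Relation.ReflTransGen (Step F) A B) : ∃ D, A ⊓ M.trunc D ≤ B := by
  induction h with
  | refl => exact ⟨0, inf_le_left⟩
  | tail _ h ih =>
    obtain ⟨D, hD⟩ := ih
    obtain ⟨E, hE⟩ := h.exists_trunc
    refine ⟨max D E, le_trans (le_inf ?_ ?_) hE⟩
    · exact (inf_le_inf_left _ (M.trunc_anti (le_max_left D E))).trans hD
    · exact inf_le_right.trans (M.trunc_anti (le_max_right D E))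

variable (F) in
/-- There is a filtration `A = N₀ ⊇ N₁ ⊇ ⋯` with factors in `F` that converges to `L`. -/
def Converges (A L : Submodule (Skew n W) M.carrier) : Prop :=
  M.IsGradedSub L ∧ ∃ N : ℕ → Submodule (Skew n W) M.carrier, N 0 = A ∧
    (∀ i, Step F (N i) (N (i + 1))) ∧ (∀ i, L ≤ N i) ∧ ∀ D, ∃ i, N i ≤ L ⊔ M.trunc D

theorem Converges.le (h : Converges F A L) : L ≤ A := by
  obtain ⟨_, N, rfl, _, hL, _⟩ := h
  exact hL 0

/-- The interchange that avoids order type `ω²`. The finite piece `B/B'` of the later filtrations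
does not interact with a sufficiently high tail of the filtration converging to `B`. So one runs
that filtration up to the tail, performs the steps from `B` to `B'` next to the tail, and keeps the
tail as a filtration converging to `B'`. -/
theorem exists_step_of_converges [∀ α, FiniteDimensional ℂ (F α).carrier]
    (h : Relation.ReflTransGen (Converges F) A L) (D : ℤ) :
    ∃ A', Relation.ReflTransGen (Step F) A A' ∧ Relation.ReflTransGen (Converges F) A' L ∧
      A' ≤ L ⊔ M.trunc D := by
  induction h using Relation.ReflTransGen.head_induction_on with
  | refl => exact ⟨L, .refl, .refl, le_sup_left⟩
  | @head A B hAB _ ih =>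
    obtain ⟨B', hBB', hB'L, hB'D⟩ := ih
    obtain ⟨hB, N, rfl, hstep, hBN, hconv⟩ := hAB
    have hB' := isGradedSub_of_reflTransGen_step hB hBB'
    have hB'B := le_of_reflTransGen_step hBB'
    obtain ⟨E₀, hE₀⟩ := exists_trunc_of_reflTransGen_step hBB'
    -- Beyond `E₀` the submodule `B` already lies in `B'`; beyond `D` the tail satisfies the
    -- required bound.
    let E := max D E₀
    have hE : B ⊓ M.trunc E ≤ B' :=
      (inf_le_inf_left _ (M.trunc_anti (le_max_right D E₀))).trans hE₀
    obtain ⟨j, hj⟩ := hconv E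
    have hanti : Antitone N := antitone_nat_of_succ_le fun i => (hstep i).le
    -- The high-degree part of the tail. By the modular law `N (j + s) = B + T s`, while `T s ∩ B`
    -- lies in `B'`.
    let T : ℕ → Submodule (Skew n W) M.carrier := fun s => N (j + s) ⊓ M.trunc E
    have hTg : ∀ s, M.IsGradedSub (T s) := fun s =>
      isGradedSub_inf (hstep _).left (M.isGradedSub_trunc E)
    have hT : ∀ s, T (s + 1) ≤ T s := fun s => inf_le_inf_right _ (hstep (j + s)).le
    have hNT : ∀ s, N (j + s) ≤ B ⊔ T s := by
      intro s
      have h1 : N (j + s) ≤ (B ⊔ M.trunc E) ⊓ N (j + s) :=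
        le_inf ((hanti (Nat.le_add_right j s)).trans hj) le_rfl
      rw [sup_inf_assoc_of_le _ (hBN (j + s)), inf_comm] at h1
      exact h1
    have hTB : ∀ s, T s ⊓ B ≤ B' := fun s =>
      (le_inf inf_le_right (inf_le_left.trans inf_le_right)).trans hE
    refine ⟨B' ⊔ T 0, ?_, .head ⟨hB', fun s => B' ⊔ T s, rfl, fun s => ?_, fun s => le_sup_left,
      fun G => ?_⟩ hB'L, ?_⟩
    -- Adding `T 0` to each term of the chain from `B` to `B'` preserves the factors, since `T 0 ∩
    -- B` lies in every term.
    · have chain : ∀ X, Relation.ReflTransGen (Step F) X B' → X ≤ B →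
          Relation.ReflTransGen (Step F) (X ⊔ T 0) (B' ⊔ T 0) := by
        intro X hX
        induction hX using Relation.ReflTransGen.head_induction_on with
        | refl => exact fun _ => .refl
        | @head X Y hXY hYB' ih =>
          intro hXB
          refine .head (hXY.up (isGradedSub_sup hXY.left (hTg 0))
            (isGradedSub_sup hXY.right (hTg 0)) (sup_le_sup_right hXY.le _) le_sup_left le_sup_left
            (sup_le le_sup_left (le_sup_right.trans le_sup_right)) ?_) (ih (hXY.le.trans hXB))
          rw [inf_comm, sup_inf_assoc_of_le _ hXY.le]
          exact sup_le le_rfl ((inf_le_inf_left _ hXB).trans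
            ((hTB 0).trans (le_of_reflTransGen_step hYB')))
      have h1 : ∀ i, Relation.ReflTransGen (Step F) (N 0) (N i) := fun i => by
        induction i with
        | zero => exact .refl
        | succ i ih => exact ih.tail (hstep i)
      have h2 : N j = B ⊔ T 0 := le_antisymm (hNT 0) (sup_le (hBN j) inf_le_left)
      exact (h1 j).trans (h2 ▸ chain B hBB' le_rfl)
    -- The tail factors survive: `N (j + s) / N (j + s + 1)`, `T s / T (s + 1)` and `(B' + T s) /
    -- (B' + T (s + 1))` are isomorphic.
    · have h1 : Step F (T s) (T (s + 1)) := by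
        refine (hstep (j + s)).down (hTg s) (hTg (s + 1)) (hT s) inf_le_left inf_le_left
          ((hNT s).trans ?_) ?_
        · exact sup_le ((hBN _).trans le_sup_right) le_sup_left
        · exact le_inf inf_le_right (inf_le_left.trans inf_le_right)
      refine h1.up (isGradedSub_sup hB' (hTg s)) (isGradedSub_sup hB' (hTg (s + 1)))
        (sup_le_sup_left (hT s) _) le_sup_right le_sup_right
        (sup_le (le_sup_left.trans le_sup_right) le_sup_left) ?_
      change T s ⊓ (B' ⊔ T (s + 1)) ≤ T (s + 1)
      rw [inf_comm, sup_comm, sup_inf_assoc_of_le _ (hT s)]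
      refine sup_le le_rfl (le_inf ?_ ?_)
      · exact inf_le_left.trans (hB'B.trans (hBN _))
      · exact inf_le_right.trans inf_le_right
    -- By the modular law an element of `T i` is the sum of one of degree above `max E G` and one in
    -- `B ∩ trunc E`, and the latter set lies in `B'`.
    · obtain ⟨i, hi⟩ := hconv (max E G)
      refine ⟨i, sup_le le_sup_left ?_⟩
      have h1 : T i ≤ (M.trunc (max E G) ⊔ B) ⊓ M.trunc E :=
        le_inf (inf_le_left.trans ((hanti (Nat.le_add_left i j)).trans (hi.trans (sup_comm _ _).le)))
          inf_le_right
      rw [sup_inf_assoc_of_le _ (M.trunc_anti (le_max_left E G))] at h1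
      exact h1.trans (sup_le ((M.trunc_anti (le_max_right E G)).trans le_sup_right)
        (hE.trans le_sup_left))
    · exact sup_le hB'D (inf_le_right.trans ((M.trunc_anti (le_max_left D E₀)).trans le_sup_right))

/-- A filtration whose steps can be refined by filtrations with factors in `F` can be replaced by a
filtration with factors in `F`. -/
theorem exists_isFilteredBy_of_converges [∀ α, FiniteDimensional ℂ (F α).carrier]
    (c : ℕ → Submodule (Skew n W) M.carrier) (h0 : c 0 = ⊤)
    (hc : ∀ i, Converges F (c i) (c (i + 1))) (hD : ∀ D, ∃ i, c i ≤ M.trunc D) :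
    ∃ Φ : SepFiltration M, Φ.IsFilteredBy F := by
  have hanti : Antitone c := antitone_nat_of_succ_le fun i => (hc i).le
  have hchain : ∀ i k, Relation.ReflTransGen (Converges F) (c i) (c (i + k)) := by
    intro i k
    induction k with
    | zero => exact .refl
    | succ k ih => exact ih.tail (hc (i + k))
  -- The invariant of the diagonal process: from the current submodule, finitely many convergent
  -- filtrations still lead to some `c i`, and further ones can be appended.
  let S := {A : Submodule (Skew n W) M.carrier //
    ∃ i, Relation.ReflTransGen (Converges F) A (c i)}
  have next : ∀ (D : ℕ) (A : S), ∃ A' : S, Relation.ReflTransGen (Step F) A.1 A'.1 ∧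
      A'.1 ≤ M.trunc D := by
    rintro D ⟨A, i, hi⟩
    obtain ⟨k, hk⟩ := hD D
    obtain ⟨A', h1, h2, h3⟩ := exists_step_of_converges (hi.trans (hchain i k)) D
    exact ⟨⟨A', _, h2⟩, h1,
      h3.trans (sup_le ((hanti (Nat.le_add_left k i)).trans hk) le_rfl)⟩
  choose f hf1 hf2 using next
  let x : ℕ → S := fun t => Nat.rec ⟨⊤, 0, h0 ▸ .refl⟩ (fun t A => f t A) t
  have hx : ∀ t, Relation.ReflTransGen (fun A B => M.IsGradedSub A → Step F A B) (x t).1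
      (x (t + 1)).1 := fun t => Relation.ReflTransGen.mono
    (show Step F ≤ fun A B => M.IsGradedSub A → Step F A B from fun _ _ h _ => h) _ _ (hf1 t (x t))
  -- `Step` is reflexive only at graded submodules. The relation is therefore guarded by gradedness,
  -- which is recovered by induction along the sequence, starting from `⊤`.
  obtain ⟨y, hy0, hy, hyx⟩ := exists_seq_of_reflTransGen
    (r := fun A B => M.IsGradedSub A → Step F A B) (fun _ => Step.refl) (fun t => (x t).1)
    hx
  have hgr : ∀ i, M.IsGradedSub (y i) := by
    intro i
    induction i with
    | zero => rw [hy0]; exact M.isGradedSub_top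
    | succ i ih => exact (hy i ih).right
  refine ⟨⟨y, hgr, hy0, fun i => (hy i (hgr i)).le, ?_⟩, fun i => (hy i (hgr i)).2.2.2⟩
  rw [eq_bot_iff]
  intro z hz
  rw [Submodule.mem_iInf] at hz
  refine eq_zero_of_forall_mem_trunc fun D => ?_
  -- The term `x (t + 1)` was chosen inside `trunc t`, hence the successor.
  obtain ⟨i, hi⟩ := hyx (D.toNat + 1)
  have h1 : z ∈ (f D.toNat (x D.toNat)).1 := by
    have := hz i
    rw [hi] at this
    exact this
  exact M.trunc_anti (Int.self_le_toNat D) (hf2 _ _ h1)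

theorem coe_proj_sub (hA : M.IsGradedSub A) (i : ℤ) (x : A) :
    ((M.sub A hA).proj i x : A).1 = M.proj i x := by
  have h := proj_comm (M := M.sub A hA) (N := M) (d := 0) (f := A.subtype)
    (fun j m hm => by rw [add_zero]; exact hm) i x
  rw [add_zero] at h
  exact h.symm

/-- A filtration of `A / B` gives a filtration of `A` that converges to `B`. -/
theorem converges_of_hom (hA : M.IsGradedSub A) (hB : M.IsGradedSub B) (hBA : B ≤ A) {G : GMod n W}
    [G.BoundedBelow] (hG : ∀ i, FiniteDimensional ℂ (G.deg i)) (Ψ : SepFiltration G)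
    (hΨ : Ψ.IsFilteredBy F) {d : ℤ} {g : A →ₗ[Skew n W] G.carrier}
    (hg : g ∈ Hom (M.sub A hA) G (-d)) (hs : Function.Surjective g)
    (hker : ∀ x : A, g x = 0 ↔ (x : M.carrier) ∈ B) : Converges F A B := by
  let N : ℕ → Submodule (Skew n W) M.carrier := fun i => ((Ψ.N i).comap g).map A.subtype
  have hN : ∀ i (x : A), (x : M.carrier) ∈ N i ↔ g x ∈ Ψ.N i := by
    intro i x
    constructor
    · rintro ⟨y, hy, hxy⟩
      rwa [← Subtype.ext hxy]
    · exact fun hx => ⟨x, hx, rfl⟩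
  have hNA : ∀ i, N i ≤ A := by
    rintro i _ ⟨y, _, rfl⟩
    exact y.2
  have hproj : ∀ (j : ℤ) (x : A), g ⟨M.proj j x, hA j x x.2⟩ = G.proj (j - d) (g x) := by
    intro j x
    have h1 := proj_comm hg j x
    rw [← sub_eq_add_neg] at h1
    exact (congrArg g (Subtype.ext (coe_proj_sub hA j x).symm)).trans h1.symm
  have hNg : ∀ i, M.IsGradedSub (N i) := by
    intro i j x hx
    rw [hN i ⟨M.proj j x, hA j x (hNA i hx)⟩, hproj j ⟨x, hNA i hx⟩]
    exact Ψ.graded i _ _ ((hN i ⟨x, hNA i hx⟩).mp hx)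
  have hle : ∀ i, N (i + 1) ≤ N i := fun i => Submodule.map_mono (Submodule.comap_mono (Ψ.anti i))
  refine ⟨hB, N, ?_, fun i => ⟨hNg i, hNg (i + 1), hle i, ?_⟩, fun i x hx => ?_, fun D => ?_⟩
  · change ((Ψ.N 0).comap g).map A.subtype = A
    rw [Ψ.zero, Submodule.comap_top, Submodule.map_top, Submodule.range_subtype]
  · let r : N i →ₗ[Skew n W] Ψ.N i := LinearMap.codRestrict (Ψ.N i)
      (g ∘ₗ Submodule.inclusion (hNA i)) (fun x => (hN i ⟨x, hNA i x.2⟩).mp x.2)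
    have hr : r ∈ Hom (M.sub (N i) (hNg i)) (G.sub (Ψ.N i) (Ψ.graded i)) (-d) := fun j x hx =>
      hg j (Submodule.inclusion (hNA i) x) hx
    let q : N i →ₗ[Skew n W] (Ψ.factor i).carrier :=
      G.toSubquot (Ψ.graded i) (Ψ.graded (i + 1)) ∘ₗ r
    have hq : q ∈ Hom (M.sub (N i) (hNg i)) (Ψ.factor i) (-d) :=
      hom_comp (M := G.sub (Ψ.N i) (Ψ.graded i)) (N := Ψ.factor i)
        (toSubquot_mem (Ψ.graded i) (Ψ.graded (i + 1))) hr (by ring)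
    have hq0 : ∀ x : N i, q x = 0 ↔ (x : M.carrier) ∈ N (i + 1) := fun x =>
      (toSubquot_eq_zero (Ψ.graded i) (Ψ.graded (i + 1)) (x := r x)).trans
        (hN (i + 1) ⟨x, hNA i x.2⟩).symm
    obtain ⟨p, hp, e⟩ := exists_subquot_lift (hNg i) (hNg (i + 1)) (N := Ψ.factor i) q hq
      fun x hx => (hq0 x).mpr hx
    have hpb : Function.Bijective p := by
      refine ⟨?_, fun y => ?_⟩
      · rw [injective_iff_map_eq_zero]
        intro y hy
        obtain ⟨x, rfl⟩ := toSubquot_surjective (hNg i) (hNg (i + 1)) y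
        rw [e, hq0] at hy
        exact (toSubquot_eq_zero (hNg i) (hNg (i + 1))).mpr hy
      · obtain ⟨⟨y, hy⟩, rfl⟩ := toSubquot_surjective (Ψ.graded i) (Ψ.graded (i + 1)) y
        obtain ⟨x, rfl⟩ := hs y
        exact ⟨M.toSubquot (hNg i) (hNg (i + 1)) ⟨x, (hN i x).mpr hy⟩, e _⟩
    rcases hΨ i with hsub | ⟨α, c, hαc⟩
    · exact Or.inl (hpb.1.subsingleton)
    · obtain ⟨f, hf, hfb⟩ := hαc.bijective_hom
      refine Or.inr ⟨α, d + c, Iso.of_bijective_hom (f := f ∘ₗ p)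
        (hom_comp hf hp (by ring)) ?_⟩
      exact hfb.comp hpb
  · refine (hN i ⟨x, hBA hx⟩).mpr ?_
    rw [(hker ⟨x, hBA hx⟩).mpr hx]
    exact Submodule.zero_mem _
  -- The map `g` lowers degrees by `d`, so components of degree at most `D` land in degree at most
  -- `D - d`, where `Ψ.N i` vanishes.
  · obtain ⟨i, hi⟩ := Ψ.exists_le_trunc hG (D - d)
    refine ⟨i, fun x hx => ?_⟩
    obtain ⟨s, hsum⟩ := M.exists_sum_proj x
    rw [← hsum]
    refine Submodule.sum_mem _ fun j _ => ?_
    by_cases hj : j ≤ D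
    · refine Submodule.mem_sup_left ((hker ⟨M.proj j x, hA j x (hNA i hx)⟩).mp ?_)
      rw [hproj j ⟨x, hNA i hx⟩]
      exact hi ((hN i ⟨x, hNA i hx⟩).mp hx) _ (by omega)
    · exact Submodule.mem_sup_right (mem_trunc_of_mem_deg (by omega) (M.proj_mem j x))

end GMod

/-- If `M` is filtered by modules which are filtered by members of `F`, then `M` is filtered by
members of `F`. -/
theorem SepFiltration.IsFilteredBy.trans {M : GMod n W} [M.BoundedBelow]
    (hM : ∀ i, FiniteDimensional ℂ (M.deg i)) {Λ Γ : Type*} {F : Λ → GMod n W}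
    [∀ α, FiniteDimensional ℂ (F α).carrier] {G : Γ → GMod n W} [∀ γ, (G γ).BoundedBelow]
    (hG : ∀ γ i, FiniteDimensional ℂ ((G γ).deg i))
    (hGF : ∀ γ, ∃ Ψ : SepFiltration (G γ), Ψ.IsFilteredBy F) {Φ : SepFiltration M}
    (hΦ : Φ.IsFilteredBy G) : ∃ Φ' : SepFiltration M, Φ'.IsFilteredBy F := by
  refine GMod.exists_isFilteredBy_of_converges Φ.N Φ.zero (fun i => ?_) (Φ.exists_le_trunc hM)
  rcases hΦ i with hs | ⟨γ, d, hd⟩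
  · have hle : Φ.N i ≤ Φ.N (i + 1) :=
      (GMod.subsingleton_subquot_iff (Φ.graded i) (Φ.graded (i + 1))).mp hs
    -- A zero factor means `Φ.N i = Φ.N (i + 1)`, so the constant sequence converges.
    exact ⟨Φ.graded _, fun _ => Φ.N i, rfl, fun _ => GMod.Step.refl (Φ.graded i),
      fun _ => Φ.anti i, fun _ => ⟨0, hle.trans le_sup_left⟩⟩
  · obtain ⟨f, hf, hb⟩ := hd.bijective_hom
    obtain ⟨Ψ, hΨ⟩ := hGF γ
    refine GMod.converges_of_hom (Φ.graded i) (Φ.graded (i + 1)) (Φ.anti i) (hG γ) Ψ hΨ (d := d)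
      (g := f ∘ₗ M.toSubquot (Φ.graded i) (Φ.graded (i + 1)))
      (GMod.hom_comp (L := M.sub (Φ.N i) (Φ.graded i)) (M := Φ.factor i) hf
        (GMod.toSubquot_mem (Φ.graded i) (Φ.graded (i + 1))) (by ring))
      (hb.2.comp (GMod.toSubquot_surjective (Φ.graded i) (Φ.graded (i + 1)))) fun x => ?_
    exact (map_eq_zero_iff f hb.1).trans
      (GMod.toSubquot_eq_zero (Φ.graded i) (Φ.graded (i + 1)))

/-! ### The modules `S ⊗ V` -/

instance finiteDimensional_polyGrade (i : ℤ) : FiniteDimensional ℂ (polyGrade n i) := by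
  refine Submodule.finiteDimensional_of_le
    (S₂ := MvPolynomial.restrictTotalDegree (Fin n) ℂ i.toNat) fun p hp => ?_
  rw [MvPolynomial.mem_restrictTotalDegree, MvPolynomial.totalDegree]
  refine Finset.sup_le fun m hm => ?_
  have h := hp (MvPolynomial.mem_support_iff.mp hm)
  rw [Finsupp.weight_apply, Finsupp.sum] at h
  simp only [nsmul_eq_mul, mul_one] at h
  rw [← h, Finsupp.sum, ← Nat.cast_sum, Int.toNat_natCast]

instance finiteDimensional_deg_quot {M : GMod n W} {N : Submodule (Skew n W) M.carrier}
    {hN : M.IsGradedSub N} (i : ℤ) [FiniteDimensional ℂ (M.deg i)] :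
    FiniteDimensional ℂ ((M.quot N hN).deg i) :=
  inferInstanceAs (FiniteDimensional ℂ ((M.deg i).map (N.mkQ.restrictScalars ℂ)))

section

variable [PreservesGrading n W] {V : Type} [AddCommGroup V] [Module ℂ V]

instance finiteDimensional_deg_freeGMod [FiniteDimensional ℂ V] (ρ : Representation ℂ W V)
    (i : ℤ) : FiniteDimensional ℂ ((freeGMod n ρ).deg i) :=
  inferInstanceAs (FiniteDimensional ℂ (LinearMap.range ((polyGrade n i).subtype.rTensor V)))

/-- The element `p ⊗ v` of `S ⊗ V`. -/
def freeTmul (ρ : Representation ℂ W V) (p : Poly n) (v : V) : (freeGMod n ρ).carrier :=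
  p ⊗ₜ[ℂ] v

theorem smul_freeTmul (ρ : Representation ℂ W V) (s p : Poly n) (w : W) (v : V) :
    (Skew.of s w : Skew n W) • freeTmul ρ p v = freeTmul ρ (s * w • p) (ρ w v) :=
  freeAction_of ρ w s p v

theorem freeTmul_mem (ρ : Representation ℂ W V) {i : ℤ} {p : Poly n} (hp : p ∈ polyGrade n i)
    (v : V) : freeTmul ρ p v ∈ (freeGMod n ρ).deg i :=
  ⟨(⟨p, hp⟩ : polyGrade n i) ⊗ₜ v, rfl⟩

theorem freeTmul_induction (ρ : Representation ℂ W V) {q : (freeGMod n ρ).carrier → Prop}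
    (zero : q 0) (tmul : ∀ p v, q (freeTmul ρ p v)) (add : ∀ x y, q x → q y → q (x + y))
    (x : (freeGMod n ρ).carrier) : q x :=
  TensorProduct.induction_on x zero tmul add

theorem freeTmul_deg_induction (ρ : Representation ℂ W V) {i : ℤ}
    {q : (freeGMod n ρ).carrier → Prop} (zero : q 0)
    (tmul : ∀ p ∈ polyGrade n i, ∀ v, q (freeTmul ρ p v))
    (add : ∀ x y, q x → q y → q (x + y)) (x : (freeGMod n ρ).carrier)
    (hx : x ∈ (freeGMod n ρ).deg i) : q x := by
  obtain ⟨x, rfl⟩ := hx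
  induction x using TensorProduct.induction_on with
  | zero => rw [map_zero]; exact zero
  | tmul p v => exact tmul p p.2 v
  | add x y hx hy => rw [map_add]; exact add _ _ hx hy

/-- The restriction of a form on `(S ⊗ V) × N` to `V × N_d`. -/
def formRestrict (ρ : Representation ℂ W V) (N : GMod n W) (d : ℤ) :
    GMod.form (freeGMod n ρ) N d →ₗ[ℂ] Representation.IntertwiningMap ρ (N.rep d).dual where
  toFun β :=
    { toFun := fun v => β.1 (freeTmul ρ 1 v) ∘ₗ (N.deg d).subtype
      map_add' := fun v v' => by
        rw [freeTmul, TensorProduct.tmul_add]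
        exact (congrArg (· ∘ₗ (N.deg d).subtype) (map_add β.1 _ _)).trans (LinearMap.add_comp _ _ _)
      map_smul' := fun c v => by
        rw [freeTmul, TensorProduct.tmul_smul]
        exact (congrArg (· ∘ₗ (N.deg d).subtype) (map_smul β.1 _ _)).trans
          (LinearMap.smul_comp _ _ _)
      isIntertwining' := fun w => by
        refine LinearMap.ext fun v => LinearMap.ext fun x => ?_
        change β.1 (freeTmul ρ 1 (ρ w v)) x =
          β.1 (freeTmul ρ 1 v) ((Skew.of 1 w⁻¹ : Skew n W) • (x : N.carrier))
        have h := β.2.1 1 w (freeTmul ρ 1 v) x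
        rwa [smul_freeTmul, smul_one, one_mul, smul_one] at h }
  map_add' _ _ := rfl
  map_smul' _ _ := rfl

theorem formRestrict_apply (ρ : Representation ℂ W V) (N : GMod n W) (d : ℤ)
    (β : GMod.form (freeGMod n ρ) N d) (v : V) (x : N.deg d) :
    formRestrict ρ N d β v x = β.1 (freeTmul ρ 1 v) x := rfl

/-- The module `S ⊗ V` is generated by `1 ⊗ V`, which sits in degree 0 and so pairs only with `N_d`;
contravariance determines the rest. -/
theorem formRestrict_injective (ρ : Representation ℂ W V) (N : GMod n W) (d : ℤ) :
    Function.Injective (formRestrict ρ N d) := by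
  rw [injective_iff_map_eq_zero]
  intro β hβ
  have h1 : ∀ v x, β.1 (freeTmul ρ 1 v) x = 0 := by
    intro v x
    induction x using N.hom_induction with
    | zero => rw [map_zero]
    | add x y hx hy => rw [map_add, hx, hy, add_zero]
    | mem j x hx =>
      by_cases hj : j = d
      · subst hj
        rw [← formRestrict_apply ρ N j β v ⟨x, hx⟩, hβ]
        rfl
      · exact β.2.2 0 j (by omega) _ (freeTmul_mem ρ one_mem_polyGrade v) x hx
  refine Subtype.ext (LinearMap.ext₂ fun m x => ?_)
  induction m using freeTmul_induction ρ with
  | zero => rw [map_zero]; rfl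
  | add m m' h h' => rw [map_add, LinearMap.add_apply, h, h']; exact add_zero _
  | tmul p v =>
    have h := β.2.1 p 1 (freeTmul ρ 1 v) x
    rw [smul_freeTmul, smul_one, mul_one, map_one, h1] at h
    exact h

/-- Contravariance forces the extension of `φ`: polynomials move to the second variable, so `β(p ⊗
v, x)` is `φ(v)` at the degree `d` component of `p x`. -/
theorem formRestrict_surjective (ρ : Representation ℂ W V) (N : GMod n W) (d : ℤ) :
    Function.Surjective (formRestrict ρ N d) := by
  intro φ
  let pr : N.carrier →ₗ[ℂ] N.deg d := (N.proj d).codRestrict (N.deg d) (N.proj_mem d)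
  let f : Poly n → V → N.carrier →ₗ[ℂ] ℂ := fun p v =>
    φ v ∘ₗ pr ∘ₗ Module.toModuleEnd ℂ (S := Skew n W) N.carrier (Skew.of p 1)
  have hf : ∀ p v x, f p v x = φ v (pr ((Skew.of p 1 : Skew n W) • x)) := fun _ _ _ => rfl
  let b : Poly n ⊗[ℂ] V →ₗ[ℂ] N.carrier →ₗ[ℂ] ℂ := TensorProduct.lift
    (LinearMap.mk₂ ℂ f
      (fun p q v => LinearMap.ext fun x => by
        rw [LinearMap.add_apply, hf, hf, hf, Skew.of_add, add_smul, map_add, map_add])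
      (fun c p v => LinearMap.ext fun x => by
        rw [LinearMap.smul_apply, hf, hf, ← Skew.smul_of, smul_assoc, map_smul, map_smul])
      (fun p v v' => LinearMap.ext fun x => by
        rw [LinearMap.add_apply, hf, hf, hf, map_add, LinearMap.add_apply])
      (fun c p v => LinearMap.ext fun x => by
        rw [LinearMap.smul_apply, hf, hf, map_smul, LinearMap.smul_apply]))
  let β : (freeGMod n ρ).carrier →ₗ[ℂ] N.carrier →ₗ[ℂ] ℂ := b
  have hβ : ∀ p v x, β (freeTmul ρ p v) x = φ v (pr ((Skew.of p 1 : Skew n W) • x)) :=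
    fun _ _ _ => rfl
  have hφ : ∀ w v (x : N.deg d), φ (ρ w v) x = φ v (N.rep d w⁻¹ x) := fun w v x =>
    LinearMap.congr_fun (Representation.IntertwiningMap.isIntertwining _ _ φ w v) x
  refine ⟨⟨β, fun s w m x => ?_, fun i j hij m hm x hx => ?_⟩, ?_⟩
  · induction m using freeTmul_induction ρ with
    | zero => rw [smul_zero, map_zero]; rfl
    | add m m' h h' => rw [smul_add, map_add, map_add, LinearMap.add_apply, h, h']; rfl
    | tmul p v =>
      rw [smul_freeTmul, hβ, hβ, hφ]
      congr 1
      refine Subtype.ext ?_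
      change (Skew.of 1 w⁻¹ : Skew n W) • N.proj d _ = N.proj d _
      have h := N.proj_smul (of_mem_skewGrade w⁻¹ one_mem_polyGrade) d
        ((Skew.of (s * w • p) 1 : Skew n W) • x)
      rw [sub_zero] at h
      rw [← h, smul_smul, smul_smul, Skew.of_mul_of, Skew.of_mul_of, one_mul, mul_one, one_smul,
        one_mul, smul_mul', inv_smul_smul, mul_comm p]
  · refine freeTmul_deg_induction ρ (q := fun m => β m x = 0) ?_ (fun p hp v => ?_)
      (fun m m' h h' => ?_) m hm
    · rw [map_zero]; rfl
    · rw [hβ]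
      have h : pr ((Skew.of p 1 : Skew n W) • x) = 0 := Subtype.ext
        (GMod.proj_of_mem_ne (Ne.symm hij) (N.smul_mem i j _ x (of_mem_skewGrade 1 hp) hx))
      rw [h, map_zero]
    · rw [map_add, LinearMap.add_apply, h, h', add_zero]
  · refine DFunLike.ext _ _ fun v => LinearMap.ext fun x => ?_
    rw [formRestrict_apply]
    change β _ _ = _
    rw [hβ, ← Skew.one_def, one_smul]
    congr 1
    exact Subtype.ext (GMod.proj_of_mem x.2)

end

/-! ### Multiplicities of irreducible representations as dimensions of forms. -/

/-- Frobenius reciprocity yields `Hom_W(λ, (N_d)^*)`. Self-duality, applied to the whole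
representation `N_d`, replaces the dual by `N_d`. -/
theorem rank_form_P [PreservesGrading n W]
    (hdual : ∀ (V : Type) [AddCommGroup V] [Module ℂ V] [FiniteDimensional ℂ V]
      (ρ : Representation ℂ W V), Nonempty (ρ.Equiv ρ.dual)) (lam : Irr W) (N : GMod n W)
    (d : ℤ) [FiniteDimensional ℂ (N.deg d)] :
    Module.rank ℂ (GMod.form (P n lam) N d) = N.mult lam d := by
  obtain ⟨e⟩ := hdual _ (N.rep d)
  let e' : Representation.IntertwiningMap lam.rep (N.rep d) ≃ₗ[ℂ]
      Representation.IntertwiningMap lam.rep (N.rep d).dual :=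
    LinearEquiv.ofBijective (Representation.IntertwiningMap.llcomp _ _ _ e.toIntertwiningMap)
      ⟨fun f g h => DFunLike.ext _ _ fun v => e.toLinearEquiv.injective (DFunLike.congr_fun h v),
        fun f => ⟨e.symm.toIntertwiningMap.comp f, DFunLike.ext _ _ fun v =>
          e.apply_symm_apply (f v)⟩⟩
  have h : Module.rank ℂ (GMod.form (P n lam) N d) = _ := (LinearEquiv.ofBijective _
    ⟨formRestrict_injective lam.rep N d, formRestrict_surjective lam.rep N d⟩).rank_eq
  rw [h, ← e'.rank_eq, GMod.mult, Module.finrank_eq_rank]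

/-- Degrees add in a nonzero pairing, so generating series of dimensions of forms are Laurent
series. -/
theorem bddBelow_support_finrank_form (M N : GMod n W) [hM : M.BoundedBelow]
    [hN : N.BoundedBelow] :
    BddBelow (Function.support fun d => (Module.finrank ℂ (GMod.form M N d) : ℤ)) := by
  obtain ⟨a, ha⟩ := hM.exists_bound
  obtain ⟨b, hb⟩ := hN.exists_bound
  refine ⟨a + b, fun d hd => ?_⟩
  by_contra hlt
  apply hd
  have h : Module.rank ℂ (GMod.form M N d) = 0 := GMod.rank_form_eq_zero fun β hβ x y =>
    GMod.form_apply_eq_zero ha hβ (fun i hi => by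
      have := N.proj_mem i y
      rw [hb i (by omega)] at this
      exact this) x
  change ((Module.finrank ℂ (GMod.form M N d) : ℕ) : ℤ) = 0
  rw [Module.finrank, h, map_zero, Nat.cast_zero]

/-! ### Orthogonality of the trace quotient modules -/

section

variable [PreservesGrading n W] [Preorder (Irr W)]

instance (lam : Irr W) (i : ℤ) : FiniteDimensional ℂ ((P n lam).deg i) :=
  finiteDimensional_deg_freeGMod lam.rep i

instance (lam : Irr W) (i : ℤ) : FiniteDimensional ℂ ((Ktilde n lam).deg i) :=
  finiteDimensional_deg_quot (M := P n lam) i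

variable [FiniteDimensional ℂ (Poly n ⧸ invariantIdeal n W)]

/-- Orthogonality enters here twice: `Ext⁰` gives the dimensions of forms on `K̃_μ × K_α`, and `Ext¹
= 0` gives additivity. -/
theorem ncard_eq_rank_form_Ktilde (horth : Orthogonality n W) (mu : Irr W) {M : GMod n W}
    [M.BoundedBelow] (hM : ∀ i, FiniteDimensional ℂ (M.deg i)) (Φ : SepFiltration M)
    (hΦ : Φ.IsFilteredBy (K n (W := W))) (d : ℤ) :
    {i | (Φ.factor i).Iso ((K n mu).shift d)}.Finite ∧
      ({i | (Φ.factor i).Iso ((K n mu).shift d)}.ncard : Cardinal) =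
        Module.rank ℂ (GMod.form (Ktilde n mu) M d) := by
  obtain ⟨R, hR⟩ := horth mu
  have h0 : ∀ α d, Module.rank ℂ (GMod.form (Ktilde n mu) (K n α) d) =
      Module.rank ℂ (R.Ext (K n α).dual 0 (-d)) := fun α d => by
    rw [R.rank_ext_zero, (GMod.formEquivHom _ _ d).rank_eq]
  refine Φ.ncard_eq_rank_form (R := R) (fun α => R.formsLift_of_ext _ fun d =>
    (hR α 1 d).2 (by simp)) ?_ (fun α d had => ?_) hM hΦ d
  · rw [h0, neg_zero]
    obtain ⟨e⟩ := (hR mu 0 0).1 ⟨rfl, rfl, rfl⟩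
    rw [e.rank_eq, Module.rank_self]
  · rw [h0]
    have := (hR α 0 (-d)).2 fun h => had ⟨h.2.2.symm, neg_eq_zero.mp h.2.1⟩
    exact rank_subsingleton' _ _

end

end

end SkewK

open SkewK in
theorem mainTheorem5 {n : ℕ} {W : Type*} [Group W] [Finite W]
    [MulSemiringAction W (Poly n)] [SMulCommClass W ℂ (Poly n)] [PreservesGrading n W]
    (hdual : ∀ (V : Type) [AddCommGroup V] [Module ℂ V] [FiniteDimensional ℂ V]
      (ρ : Representation ℂ W V), Nonempty (ρ.Equiv ρ.dual))
    [FiniteDimensional ℂ (Poly n ⧸ invariantIdeal n W)]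
    [Preorder (Irr W)]
    (horth : Orthogonality n W)
    (hPKt : HasKtildeFiltrations n W)
    (hKtK : HasKFiltrations n W) :
    (∃ C : Matrix (Irr W) (Irr W) ℤ⸨X⸩,
      (∀ (lam : Irr W) (Φ : SepFiltration (Ktilde n lam)), Φ.IsFilteredBy (K n (W := W)) →
        Φ.HasMultiplicities (K n) (C lam)) ∧
      C.IsSymm) ∧
    (∀ lam : Irr W, ∃ Φ : SepFiltration (P n lam), Φ.IsFilteredBy (K n (W := W))) ∧
    (∀ (lam : Irr W) (Φ : SepFiltration (P n lam)), Φ.IsFilteredBy (K n (W := W)) →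
      Φ.HasMultiplicities (K n) ((KtildeL n W).transpose lam)) := by
  -- The matrix is defined by dimensions of forms, without reference to a filtration; independence
  -- of the filtration is then automatic.
  refine ⟨⟨Matrix.of fun lam mu => HahnSeries.ofSuppBddBelow
    (fun d => (Module.finrank ℂ (GMod.form (Ktilde n mu) (Ktilde n lam) d) : ℤ))
    (bddBelow_support_finrank_form _ _), fun lam Φ hΦ mu d => ?_, ?_⟩, fun lam => ?_,
    fun lam Φ hΦ mu d => ?_⟩
  · obtain ⟨h1, h2⟩ := ncard_eq_rank_form_Ktilde horth mu (fun i => inferInstance) Φ hΦ d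
    refine ⟨h1, ?_⟩
    change _ = ((Module.finrank ℂ (GMod.form (Ktilde n mu) (Ktilde n lam) d) : ℕ) : ℤ)
    -- The rank equals a natural number, so `finrank` is the true dimension and not its default
    -- value 0.
    rw [Module.finrank, ← h2, Cardinal.toNat_natCast]
  · refine Matrix.IsSymm.ext fun lam mu => HahnSeries.ext (funext fun d => ?_)
    change ((Module.finrank ℂ (GMod.form (Ktilde n lam) (Ktilde n mu) d) : ℕ) : ℤ) =
      ((Module.finrank ℂ (GMod.form (Ktilde n mu) (Ktilde n lam) d) : ℕ) : ℤ)
    rw [(GMod.formFlip _ _ d).finrank_eq]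
  · obtain ⟨Φ, hΦ⟩ := hPKt lam
    exact hΦ.trans (fun i => inferInstance) (fun mu i => inferInstance) hKtK
  · obtain ⟨h1, h2⟩ := ncard_eq_rank_form_Ktilde horth mu (fun i => inferInstance) Φ hΦ d
    refine ⟨h1, ?_⟩
    change _ = (((Ktilde n mu).mult lam d : ℕ) : ℤ)
    -- Interchanging the variables puts `P_λ` first, where Frobenius reciprocity applies.
    rw [(GMod.formFlip _ _ d).rank_eq, rank_form_P hdual] at h2
    exact congrArg Nat.cast (Nat.cast_injective h2)
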